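/- For $\gamma>0$ let $f_\gamma:[0,1]\to[0,1]$ be $f_\gamma(x)=x(1+2^\gamma x^\gamma)$ for $x\in[0,\tfrac12)$ and $f_\gamma(x)=2x-1$ for $x\in[\tfrac12,1]$. Let $0<\alpha<1$, $\alpha\le\beta<\infty$, and let $\nu$ be a probability measure on $[\alpha,\beta]$ such that $\alpha$ lies in its topological support, i.e. $\nu([\alpha,\alpha+\delta])>0$ for every $\delta>0$. Put $\Omega=[\alpha,\beta]^{\mathbb N_0}$ and $F(\boldsymbol\omega,x)=(\sigma\boldsymbol\omega,f_{\omega_0}(x))$ on $\Omega\times[0,1]$, where $\sigma$ is the left shift. Let $\mathbb P=\nu^{\mathbb N_0}\otimes m$ with $m$ Lebesgue measure on $[0,1]$, let $Y=\Omega\times[\tfrac12,1]$, and let $\mathbb P_Y$ be the normalised restriction of $\mathbb P$ to $Y$. For $(\boldsymbol\omega,x)\in Y$ let $\tau_Y(\boldsymbol\omega,x)=\inf\{n\ge1: F^n(\boldsymbol\omega,x)\in Y\}$ (finite unless $x=\tfrac12$). For a Lipschitz function $\phi:[0,1]\to\mathbb R$ put $$\phi_Y(\boldsymbol\omega,x)=\sum_{i=0}^{\tau_Y(\boldsymbol\omega,x)-1}\phi\bigl(\pi_2(F^i(\boldsymbol\omega,x))\bigr),\qquad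 G(t)=\mathbb P_Y\bigl(\{(\boldsymbol\omega,x):\phi_Y(\boldsymbol\omega,x)\le t\}\bigr),$$ where $\pi_2$ is the projection to the second coordinate. If $\phi(0)>0$, then there is a function $L$, slowly varying at $+\infty$, such that $$1-G(t)=t^{-1/\alpha}L(t)\qquad\text{for all } t>0.$$ Here $L$ is slowly varying at $+\infty$ if it is positive and measurable on some half-line $[X,\infty)$ and $L(ct)/L(t)\to1$ as $t\to\infty$ for every $c>0$. -/

import Mathlib

noncomputable section

namespace RandomLSV

open MeasureTheory Filter Topology ProbabilityTheory

/-- The Liverani–Saussol–Vaienti map `f_γ`. For `γ > 0` it maps `[0,1]` into itself; only its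
restriction to `[0,1]` is used. -/
def lsv (γ x : ℝ) : ℝ :=
  if x < 1 / 2 then x * (1 + 2 ^ γ * x ^ γ) else 2 * x - 1

/-- The parameter sequences `[α,β]^{ℕ₀}`. -/
abbrev Params (α β : ℝ) : Type := ℕ → Set.Icc α β

/-- The skew product `F(ω, x) = (σω, f_{ω₀}(x))`. The second coordinate is a real number; the set
`{x ∈ [0,1]}` is forward invariant when `0 < α` and has full measure for `refMeasure`. -/
def skew {α β : ℝ} (p : Params α β × ℝ) : Params α β × ℝ :=
  (fun n => p.1 (n + 1), lsv (p.1 0) p.2)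

/-- The reference measure `ν^{ℕ₀} ⊗ m`, with `m` Lebesgue measure on `[0,1]`. -/
def refMeasure {α β : ℝ} (ν : Measure (Set.Icc α β)) [IsProbabilityMeasure ν] :
    Measure (Params α β × ℝ) :=
  (Measure.infinitePi (fun _ : ℕ => ν)).prod (volume.restrict (Set.Icc (0 : ℝ) 1))

/-- The inducing set `Y = Ω × [1/2, 1]`. -/
def inducing (α β : ℝ) : Set (Params α β × ℝ) :=
  Set.univ ×ˢ Set.Icc (1 / 2 : ℝ) 1

/-- The reference measure restricted to `Y` and normalised. -/
def inducedMeasure {α β : ℝ} (ν : Measure (Set.Icc α β)) [IsProbabilityMeasure ν] :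
    Measure (Params α β × ℝ) :=
  cond (refMeasure ν) (inducing α β)

/-- The first return time `inf {n ≥ 1 | Fⁿ(ω, x) ∈ Y}`. On `Y` the infimum is over the empty set
(and then `0` by convention) only when `x = 1/2`, which is a null set. -/
def returnTime {α β : ℝ} (p : Params α β × ℝ) : ℕ :=
  sInf {n : ℕ | 1 ≤ n ∧ skew^[n] p ∈ inducing α β}

/-- The induced observable: the sum of `φ ∘ π₂` along the excursion from `Y`. -/
def inducedObs {α β : ℝ} (φ : ℝ → ℝ) (p : Params α β × ℝ) : ℝ :=
  ∑ i ∈ Finset.range (returnTime p), φ (skew^[i] p).2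

/-- The distribution function `G` of the induced observable. -/
def distFun {α β : ℝ} (ν : Measure (Set.Icc α β)) [IsProbabilityMeasure ν] (φ : ℝ → ℝ)
    (t : ℝ) : ℝ :=
  (inducedMeasure ν).real {p | inducedObs φ p ≤ t}

/-- Slow variation at `+∞`: `L` is positive and measurable on some half-line `[X, ∞)`, and
`L(c x) / L(x) → 1` as `x → ∞` for every `c > 0`. -/
def IsSlowlyVarying (L : ℝ → ℝ) : Prop :=
  (∃ X : ℝ, (∀ x, X ≤ x → 0 < L x) ∧ Measurable (fun x : Set.Ici X => L x)) ∧
    ∀ c : ℝ, 0 < c → Tendsto (fun x => L (c * x) / L x) atTop (𝓝 1)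

end RandomLSV

end

noncomputable section

namespace RandomLSV

open MeasureTheory Filter Topology ProbabilityTheory

/-! Write q(x) = `moment ν x` = ∫ (2x)^γ dν(γ). A step of the left branch multiplies x by 1 +
(2x)^γ, and 1/q serves as a clock: near 0 a step lowers it by about α·w, where w = (2x)^γ/q(x) has
ν-mean one (`inv_moment_step`). The constant is α because the probability measure (2x)^γ/q(x) dν
concentrates at α as x → 0, α being in the support (`tendsto_weighted_div_moment`). The same
concentration makes q regularly varying at 0 with index α.

Hence an orbit starting at z takes about 1/(α q(z)) steps to leave a neighbourhood of 0.
Fluctuations are controlled by exponential moments: w is O(z^(-α/2)) on the relevant range, so a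
Chernoff exponent of order z^(α/2) is allowed, and the resulting errors exp(-const·z^(α/2)/q(z)) are
o(z) (`exists_sojourn_bounds`, `eventually_exp_neg_le`). On Y the first step x ↦ 2x - 1 makes the
entry point uniform on [0,1], so the chance of an excursion longer than n is asymptotic to the z
with 1/q(z) = αn.

Finally the induced observable is φ(0) times the return time up to a small relative error and a
constant (`inducedObs_bounds`), so 1 - G(t) is asymptotic to the z with 1/q(z) = αt/φ(0), an inverse
of a regularly varying function. Its index is -1/α. -/

/-- The moment function `x ↦ ∫ (2x)^γ dν(γ)`. -/
def moment {α β : ℝ} (ν : Measure (Set.Icc α β)) (x : ℝ) : ℝ := ∫ γ, (2 * x) ^ (γ : ℝ) ∂ν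

/-! ### Moment function: regular variation and the one-step drift of its reciprocal. -/

section Moment

variable {α β : ℝ} {ν : Measure (Set.Icc α β)} [IsProbabilityMeasure ν]

theorem integrable_of_continuous {g : Set.Icc α β → ℝ} (hg : Continuous g) : Integrable g ν :=
  hg.integrable_of_hasCompactSupport (HasCompactSupport.of_compactSpace g)

theorem continuous_rpow_param {y : ℝ} (hy : 0 < y) :
    Continuous fun γ : Set.Icc α β => y ^ (γ : ℝ) :=
  (Real.continuous_const_rpow hy.ne').comp continuous_subtype_val

theorem integrable_rpow {x : ℝ} (hx : 0 < x) :
    Integrable (fun γ : Set.Icc α β => (2 * x) ^ (γ : ℝ)) ν :=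
  integrable_of_continuous (continuous_rpow_param (by positivity))

theorem moment_le {x : ℝ} (hx : 0 < x) (hx1 : 2 * x ≤ 1) : moment ν x ≤ (2 * x) ^ α := by
  have h := integral_mono (μ := ν) (integrable_rpow hx) (integrable_const ((2 * x) ^ α))
    (fun γ => Real.rpow_le_rpow_of_exponent_ge (by positivity) hx1 γ.2.1)
  simpa [moment] using h

theorem le_moment {x : ℝ} (hx : 0 < x) (hx1 : 2 * x ≤ 1) (δ : ℝ) :
    ν.real {γ | (γ : ℝ) ≤ α + δ} * (2 * x) ^ (α + δ) ≤ moment ν x := by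
  have hm : MeasurableSet {γ : Set.Icc α β | (γ : ℝ) ≤ α + δ} :=
    measurableSet_le measurable_subtype_coe measurable_const
  have h := integral_mono (μ := ν)
    (f := Set.indicator {γ : Set.Icc α β | (γ : ℝ) ≤ α + δ} fun _ => (2 * x) ^ (α + δ))
    ((integrable_const _).indicator hm) (integrable_rpow hx) (by
      intro γ
      by_cases hγ : (γ : ℝ) ≤ α + δ
      · simpa [Set.indicator, hγ] using
          Real.rpow_le_rpow_of_exponent_ge (by positivity) hx1 hγ
      · simp only [Set.indicator, Set.mem_ofPred_eq, hγ, if_false]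
        positivity)
  rw [integral_indicator_const _ hm] at h
  simpa [moment] using h

theorem moment_pos {x : ℝ} (hx : 0 < x) : 0 < moment ν x := by
  have h0 : ∀ γ : Set.Icc α β, 0 < (2 * x) ^ (γ : ℝ) := fun γ => by positivity
  have hs : Function.support (fun γ : Set.Icc α β => (2 * x) ^ (γ : ℝ)) = Set.univ :=
    Set.eq_univ_of_forall fun γ => (h0 γ).ne'
  rw [moment, integral_pos_iff_support_of_nonneg (fun γ => (h0 γ).le) (integrable_rpow hx), hs]
  simp

theorem moment_mono {x y : ℝ} (hα : 0 ≤ α) (hx : 0 < x) (hxy : x ≤ y) :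
    moment ν x ≤ moment ν y :=
  integral_mono (integrable_rpow hx) (integrable_rpow (hx.trans_le hxy)) fun γ =>
    Real.rpow_le_rpow (by positivity) (by linarith) (hα.trans γ.2.1)

theorem rpow_mul_moment_le {x s : ℝ} (hx : 0 < x) (hs : 0 ≤ s) :
    (1 + s) ^ α * moment ν x ≤ moment ν (x * (1 + s)) := by
  rw [moment, moment, ← integral_const_mul]
  refine integral_mono ((integrable_rpow hx).const_mul _) (integrable_rpow (by positivity)) ?_
  intro γ
  have h1 : (1 + s) ^ α ≤ (1 + s) ^ (γ : ℝ) :=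
    Real.rpow_le_rpow_of_exponent_le (by linarith) γ.2.1
  have h2 : (2 * (x * (1 + s))) ^ (γ : ℝ) = (1 + s) ^ (γ : ℝ) * (2 * x) ^ (γ : ℝ) := by
    rw [← Real.mul_rpow (by positivity) (by positivity)]; ring_nf
  simp only [h2]
  gcongr

/-- Follows from (1+s)^γ - 1 ≤ γ s e^(βs). The factor γ is kept under the integral, rather than
bounded by β, so that concentration can later replace it by α. -/
theorem moment_mul_sub_le {x s : ℝ} (hα : 0 < α) (hx : 0 < x) (hs : 0 ≤ s) :
    moment ν (x * (1 + s)) - moment ν x ≤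
      s * Real.exp (β * s) * ∫ γ, (γ : ℝ) * (2 * x) ^ (γ : ℝ) ∂ν := by
  have hi : Integrable (fun γ : Set.Icc α β => (γ : ℝ) * (2 * x) ^ (γ : ℝ)) ν :=
    integrable_of_continuous (continuous_subtype_val.mul (continuous_rpow_param (by positivity)))
  rw [moment, moment, ← integral_sub (integrable_rpow (by positivity)) (integrable_rpow hx),
    ← integral_const_mul]
  refine integral_mono ((integrable_rpow (by positivity)).sub (integrable_rpow hx))
    (hi.const_mul _) ?_
  intro γ
  have hγ : 0 < (γ : ℝ) := hα.trans_le γ.2.1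
  have h2 : (2 * (x * (1 + s))) ^ (γ : ℝ) = (1 + s) ^ (γ : ℝ) * (2 * x) ^ (γ : ℝ) := by
    rw [← Real.mul_rpow (by positivity) (by positivity)]; ring_nf
  have h3 : (1 + s) ^ (γ : ℝ) - 1 ≤ s * Real.exp (β * s) * γ := by
    have h4 : (1 + s) ^ (γ : ℝ) ≤ Real.exp (γ * s) := by
      rw [mul_comm, Real.exp_mul]
      exact Real.rpow_le_rpow (by positivity) (by linarith [Real.add_one_le_exp s]) hγ.le
    have h5 : Real.exp (γ * s) - 1 ≤ γ * s * Real.exp (γ * s) := by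
      have := Real.add_one_le_exp (-(γ * s))
      have h6 := Real.exp_pos (γ * s)
      have h7 : Real.exp (-(γ * s)) * Real.exp (γ * s) = 1 := by
        rw [← Real.exp_add]; simp
      nlinarith
    have h6 : Real.exp (γ * s) ≤ Real.exp (β * s) :=
      Real.exp_le_exp.2 (mul_le_mul_of_nonneg_right γ.2.2 hs)
    have h7 : γ * s * Real.exp (γ * s) ≤ γ * s * Real.exp (β * s) := by gcongr
    linarith
  have h8 : 0 < (2 * x) ^ (γ : ℝ) := by positivity
  simp only [h2]
  nlinarith

theorem continuousOn_moment (hα : 0 < α) : ContinuousOn (moment ν) (Set.Ioi 0) := by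
  intro x hx
  refine ContinuousAt.continuousWithinAt ?_
  have hx : 0 < x := hx
  have hx1 : 0 < x + 1 := by linarith
  refine continuousAt_of_dominated (bound := fun γ : Set.Icc α β => (2 * (x + 1)) ^ (γ : ℝ))
    ?_ ?_ (integrable_rpow hx1) ?_
  · filter_upwards [lt_mem_nhds hx] with y hy using (integrable_rpow hy).aestronglyMeasurable
  · filter_upwards [lt_mem_nhds hx, gt_mem_nhds (show x < x + 1 by linarith)] with y hy hy1
    refine Eventually.of_forall fun γ => ?_
    have : 0 < (2 * y) ^ (γ : ℝ) := by positivity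
    rw [Real.norm_of_nonneg this.le]
    exact Real.rpow_le_rpow (by positivity) (by linarith) (hα.le.trans γ.2.1)
  · refine Eventually.of_forall fun γ => ?_
    exact (continuousAt_const.mul continuousAt_id).rpow_const (Or.inl (mul_pos two_pos hx).ne')

theorem measureReal_param_pos (hν : ∀ δ : ℝ, 0 < δ → 0 < ν {γ | (γ : ℝ) ≤ α + δ}) {δ : ℝ}
    (hδ : 0 < δ) : 0 < ν.real {γ | (γ : ℝ) ≤ α + δ} :=
  ENNReal.toReal_pos (hν δ hδ).ne' (measure_ne_top _ _)

theorem tendsto_two_mul_rpow {p : ℝ} (hp : 0 < p) :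
    Tendsto (fun x : ℝ => (2 * x) ^ p) (𝓝[>] 0) (𝓝 0) := by
  have h : ContinuousAt (fun x : ℝ => (2 * x) ^ p) 0 :=
    (continuousAt_const.mul continuousAt_id).rpow_const (Or.inr hp.le)
  have := h.tendsto
  simp only [mul_zero, Real.zero_rpow hp.ne'] at this
  exact this.mono_left nhdsWithin_le_nhds

/-- The support hypothesis at δ/2 bounds the moment below by a constant times (2x)^(α+δ/2), which
leaves a spare factor (2x)^(δ/2). -/
theorem tendsto_rpow_div_moment (hν : ∀ δ : ℝ, 0 < δ → 0 < ν {γ | (γ : ℝ) ≤ α + δ}) {δ : ℝ}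
    (hδ : 0 < δ) :
    Tendsto (fun x => (2 * x) ^ (α + δ) / moment ν x) (𝓝[>] 0) (𝓝 0) := by
  set m := ν.real {γ | (γ : ℝ) ≤ α + δ / 2} with hm_def
  have hm : 0 < m := measureReal_param_pos hν (half_pos hδ)
  have h1 : Tendsto (fun x : ℝ => (2 * x) ^ (δ / 2) / m) (𝓝[>] 0) (𝓝 0) := by
    simpa using (tendsto_two_mul_rpow (half_pos hδ)).div_const m
  refine squeeze_zero' ?_ ?_ h1
  · filter_upwards [self_mem_nhdsWithin] with x hx
    have hx : 0 < x := hx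
    have := moment_pos (ν := ν) hx
    positivity
  · filter_upwards [Ioo_mem_nhdsGT (show (0 : ℝ) < 1 / 2 by norm_num)] with x hx
    have h2 := le_moment (ν := ν) hx.1 (by linarith [hx.2]) (δ / 2)
    have hx0 := hx.1
    rw [div_le_div_iff₀ (moment_pos hx.1) hm]
    have h3 : (2 * x) ^ (α + δ) = (2 * x) ^ (δ / 2) * (2 * x) ^ (α + δ / 2) := by
      rw [← Real.rpow_add (by positivity)]; ring_nf
    have h4 : 0 < (2 * x) ^ (δ / 2) := by positivity
    rw [h3]
    nlinarith

/-- The measures (2x)^γ/q(x) dν converge weakly to the point mass at α: exponents near α give g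
close to g(α), and the others carry mass O((2x)^(α+δ/2)/q(x)), which vanishes. -/
theorem tendsto_weighted_div_moment (hν : ∀ δ : ℝ, 0 < δ → 0 < ν {γ | (γ : ℝ) ≤ α + δ})
    {g : ℝ → ℝ} (hg : Continuous g) :
    Tendsto (fun x => (∫ γ, g γ * (2 * x) ^ (γ : ℝ) ∂ν) / moment ν x) (𝓝[>] 0)
      (𝓝 (g α)) := by
  obtain ⟨B, hB⟩ := (isCompact_Icc (a := α) (b := β)).exists_bound_of_continuousOn
    (f := fun y => g y - g α) (hg.sub continuous_const).continuousOn
  rw [Metric.tendsto_nhds]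
  intro ε hε
  obtain ⟨δ, hδ, hgδ⟩ := Metric.continuousAt_iff.1 (hg.continuousAt (x := α)) (ε / 2) (half_pos hε)
  have hlim := (tendsto_rpow_div_moment hν (half_pos hδ)).const_mul |B|
  rw [mul_zero] at hlim
  filter_upwards [hlim.eventually (gt_mem_nhds (half_pos hε)),
    Ioo_mem_nhdsGT (show (0 : ℝ) < 1 / 2 by norm_num)] with x hx1 hx
  have hx0 := hx.1
  have hq := moment_pos (ν := ν) hx.1
  have hi : Integrable (fun γ : Set.Icc α β => g γ * (2 * x) ^ (γ : ℝ)) ν :=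
    integrable_of_continuous ((hg.comp continuous_subtype_val).mul
      (continuous_rpow_param (by positivity)))
  have h1 : (∫ γ, g γ * (2 * x) ^ (γ : ℝ) ∂ν) / moment ν x - g α =
      (∫ γ, (g γ * (2 * x) ^ (γ : ℝ) - g α * (2 * x) ^ (γ : ℝ)) ∂ν) / moment ν x := by
    rw [integral_sub hi ((integrable_rpow hx.1).const_mul _), integral_const_mul]
    change _ = (_ - g α * moment ν x) / moment ν x
    field_simp
  have h2 : |∫ γ, (g γ * (2 * x) ^ (γ : ℝ) - g α * (2 * x) ^ (γ : ℝ)) ∂ν| ≤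
      ε / 2 * moment ν x + |B| * (2 * x) ^ (α + δ / 2) := by
    have h3 : ∫ γ, (ε / 2 * (2 * x) ^ (γ : ℝ) + |B| * (2 * x) ^ (α + δ / 2)) ∂ν =
        ε / 2 * moment ν x + |B| * (2 * x) ^ (α + δ / 2) := by
      rw [integral_add ((integrable_rpow hx.1).const_mul _) (integrable_const _),
        integral_const_mul]
      simp [moment]
    rw [← h3, ← Real.norm_eq_abs]
    refine norm_integral_le_of_norm_le
      (((integrable_rpow hx.1).const_mul _).add (integrable_const _)) ?_
    refine Eventually.of_forall fun γ => ?_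
    have hp : 0 < (2 * x) ^ (γ : ℝ) := by positivity
    have hp' : 0 < (2 * x) ^ (α + δ / 2) := by positivity
    rw [← sub_mul, norm_mul, Real.norm_of_nonneg hp.le]
    by_cases hγ : (γ : ℝ) ≤ α + δ / 2
    · have h4 : |g γ - g α| < ε / 2 := by
        refine hgδ ?_
        rw [Real.dist_eq, abs_of_nonneg (by linarith [γ.2.1])]
        linarith
      rw [Real.norm_eq_abs]
      have : 0 ≤ |B| * (2 * x) ^ (α + δ / 2) := by positivity
      nlinarith
    · have h4 : ‖g γ - g α‖ ≤ |B| := (hB γ γ.2).trans (le_abs_self B)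
      have h5 : (2 * x) ^ (γ : ℝ) ≤ (2 * x) ^ (α + δ / 2) :=
        Real.rpow_le_rpow_of_exponent_ge (by positivity) (by linarith [hx.2]) (by linarith)
      have h6 : ‖g γ - g α‖ * (2 * x) ^ (γ : ℝ) ≤ |B| * (2 * x) ^ (α + δ / 2) := by gcongr
      have : 0 ≤ ε / 2 * (2 * x) ^ (γ : ℝ) := by positivity
      linarith
  rw [Real.dist_eq, h1, abs_div, abs_of_pos hq, div_lt_iff₀ hq]
  rw [← mul_div_assoc, div_lt_iff₀ hq] at hx1
  linarith

/-- The moment function is regularly varying at `0` with index `α`. -/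
theorem tendsto_moment_mul_div (hν : ∀ δ : ℝ, 0 < δ → 0 < ν {γ | (γ : ℝ) ≤ α + δ}) {c : ℝ}
    (hc : 0 < c) : Tendsto (fun x => moment ν (c * x) / moment ν x) (𝓝[>] 0) (𝓝 (c ^ α)) := by
  refine (tendsto_weighted_div_moment hν (Real.continuous_const_rpow hc.ne')).congr' ?_
  filter_upwards [self_mem_nhdsWithin] with x hx
  have hx : 0 < x := hx
  congr 1
  refine integral_congr_ae (Eventually.of_forall fun γ => ?_)
  simp only
  rw [← Real.mul_rpow hc.le (by positivity)]
  ring_nf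

/-- One step of the left branch lowers `1 / moment` by about `α (2x)^γ / moment ν x`. -/
theorem inv_moment_step (hα : 0 < α) (hν : ∀ δ : ℝ, 0 < δ → 0 < ν {γ | (γ : ℝ) ≤ α + δ})
    {ε : ℝ} (hε : 0 < ε) :
    ∃ δ₀ : ℝ, 0 < δ₀ ∧ δ₀ < 1 / 2 ∧ ∀ x : ℝ, 0 < x → x ≤ δ₀ → ∀ γ : Set.Icc α β,
      (moment ν x)⁻¹ - α * (1 + ε) * ((2 * x) ^ (γ : ℝ) * (moment ν x)⁻¹) ≤
          (moment ν (x * (1 + (2 * x) ^ (γ : ℝ))))⁻¹ ∧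
        (moment ν (x * (1 + (2 * x) ^ (γ : ℝ))))⁻¹ ≤
          (moment ν x)⁻¹ - α * (1 - ε) * ((2 * x) ^ (γ : ℝ) * (moment ν x)⁻¹) := by
  have h1 : Tendsto (fun x : ℝ => Real.exp (β * (2 * x) ^ α) *
      ((∫ γ, (γ : ℝ) * (2 * x) ^ (γ : ℝ) ∂ν) / moment ν x)) (𝓝[>] 0) (𝓝 α) := by
    have h2 := (Real.continuous_exp.tendsto _).comp ((tendsto_two_mul_rpow hα).const_mul β)
    have h3 := h2.mul (tendsto_weighted_div_moment hν continuous_id)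
    simpa using h3
  have h4 : ∀ᶠ x : ℝ in 𝓝[>] 0, (1 + α) * (2 * x) ^ α < ε := by
    have := (tendsto_two_mul_rpow hα).const_mul (1 + α)
    rw [mul_zero] at this
    exact this.eventually (gt_mem_nhds hε)
  have h5 := (h1.eventually (gt_mem_nhds (show α < α * (1 + ε) by nlinarith))).and h4
  obtain ⟨u, hu, hu'⟩ := (mem_nhdsGT_iff_exists_Ioc_subset).1 h5
  have hu : 0 < u := hu
  refine ⟨min u (1 / 4), by positivity, (min_le_right _ _).trans_lt (by norm_num), ?_⟩
  intro x hx hxu γ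
  obtain ⟨h6, h7⟩ := hu' ⟨hx, hxu.trans (min_le_left _ _)⟩
  have hx1 : 2 * x ≤ 1 := by linarith [hxu.trans (min_le_right _ _)]
  set s := (2 * x) ^ (γ : ℝ) with hs_def
  have hs : 0 < s := by positivity
  have hsα : s ≤ (2 * x) ^ α := Real.rpow_le_rpow_of_exponent_ge (by positivity) hx1 γ.2.1
  have hq := moment_pos (ν := ν) hx
  have hq' : 0 < moment ν (x * (1 + s)) := moment_pos (by positivity)
  have hmono : moment ν x ≤ moment ν (x * (1 + s)) := moment_mono hα.le hx (by nlinarith)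
  have hβ : 0 < β := hα.trans_le (γ.2.1.trans γ.2.2)
  constructor
  · have h8 := moment_mul_sub_le (ν := ν) hα hx hs.le
    have h9 : moment ν (x * (1 + s)) - moment ν x ≤ α * (1 + ε) * s * moment ν x := by
      refine h8.trans ?_
      have hexp : Real.exp (β * s) ≤ Real.exp (β * (2 * x) ^ α) :=
        Real.exp_le_exp.2 (by gcongr)
      have hI : 0 ≤ ∫ γ, (γ : ℝ) * (2 * x) ^ (γ : ℝ) ∂ν :=
        integral_nonneg fun γ => mul_nonneg (hα.le.trans γ.2.1) (by positivity)
      rw [← mul_div_assoc, div_lt_iff₀ hq] at h6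
      calc s * Real.exp (β * s) * ∫ γ, (γ : ℝ) * (2 * x) ^ (γ : ℝ) ∂ν
          ≤ s * Real.exp (β * (2 * x) ^ α) * ∫ γ, (γ : ℝ) * (2 * x) ^ (γ : ℝ) ∂ν := by gcongr
        _ = s * (Real.exp (β * (2 * x) ^ α) * ∫ γ, (γ : ℝ) * (2 * x) ^ (γ : ℝ) ∂ν) := by ring
        _ ≤ s * (α * (1 + ε) * moment ν x) := by gcongr
        _ = _ := by ring
    have h10 : (moment ν x)⁻¹ - (moment ν (x * (1 + s)))⁻¹ ≤
        α * (1 + ε) * (s * (moment ν x)⁻¹) := by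
      rw [inv_sub_inv hq.ne' hq'.ne', div_le_iff₀ (by positivity)]
      calc _ ≤ α * (1 + ε) * s * moment ν x := h9
        _ ≤ α * (1 + ε) * s * moment ν (x * (1 + s)) := by gcongr
        _ = _ := by field_simp
    linarith
  · have h8 := rpow_mul_moment_le (ν := ν) hx hs.le
    have h9 : 1 + α * (s / (1 + s)) ≤ (1 + s) ^ α := by
      rw [Real.rpow_def_of_pos (by positivity)]
      have h10 := Real.one_sub_inv_le_log_of_pos (show 0 < 1 + s by positivity)
      have h11 := Real.add_one_le_exp (Real.log (1 + s) * α)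
      have h12 : s / (1 + s) = 1 - (1 + s)⁻¹ := by field_simp; ring
      rw [h12]
      nlinarith
    have hsε : (1 + α) * s < ε := lt_of_le_of_lt (by gcongr) h7
    have h10 : (1 + α * (s / (1 + s))) * moment ν x ≤ moment ν (x * (1 + s)) :=
      (mul_le_mul_of_nonneg_right h9 hq.le).trans h8
    have h11 : (moment ν (x * (1 + s)))⁻¹ ≤ ((1 + α * (s / (1 + s))) * moment ν x)⁻¹ :=
      inv_anti₀ (by positivity) h10
    -- The left side is 1 - αs/(1 + (1+α)s), and (1+α)s < ε.
    have h12 : (1 + α * (s / (1 + s)))⁻¹ ≤ 1 - α * (1 - ε) * s := by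
      have h13 : (1 + α * (s / (1 + s)))⁻¹ = (1 + s) / (1 + s + α * s) := by field_simp
      have h14 : 0 < α * s := by positivity
      rw [h13, div_le_iff₀ (by positivity)]
      nlinarith [mul_pos h14 hε, mul_nonneg h14.le (sub_nonneg.2 hsε.le),
        mul_pos (mul_pos h14 hε) (show 0 < s + α * s by positivity)]
    rw [mul_inv] at h11
    have h15 : 0 < (moment ν x)⁻¹ := by positivity
    nlinarith

end Moment

/-! ### Measurability of the skew product and of sojourn sets. -/

section Measurability

theorem measurable_lsv : Measurable fun p : ℝ × ℝ => lsv p.1 p.2 := by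
  unfold lsv
  refine Measurable.ite (measurableSet_lt measurable_snd measurable_const) ?_ ?_ <;> fun_prop

variable {α β : ℝ}

theorem measurable_skew : Measurable (skew : Params α β × ℝ → Params α β × ℝ) := by
  unfold skew
  refine Measurable.prodMk ?_ ?_
  · exact measurable_pi_iff.2 fun n => (measurable_pi_apply (n + 1)).comp measurable_fst
  · exact measurable_lsv.comp ((measurable_subtype_coe.comp
      ((measurable_pi_apply 0).comp measurable_fst)).prodMk measurable_snd)

/-- The points whose first `n` iterates (counting the point itself) stay at most `δ`. -/
def sojourn (α β δ : ℝ) (n : ℕ) : Set (Params α β × ℝ) :=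
  {p | ∀ k < n, (skew^[k] p).2 ≤ δ}

theorem measurableSet_sojourn (δ : ℝ) (n : ℕ) : MeasurableSet (sojourn α β δ n) := by
  have : sojourn α β δ n = ⋂ k ∈ Finset.range n, {p | (skew^[k] p).2 ≤ δ} := by
    ext p; simp [sojourn]
  rw [this]
  exact Finset.measurableSet_biInter _ fun k _ =>
    measurableSet_le (measurable_snd.comp (measurable_skew.iterate k)) measurable_const

theorem mem_sojourn_succ {δ : ℝ} {n : ℕ} {p : Params α β × ℝ} :
    p ∈ sojourn α β δ (n + 1) ↔ p.2 ≤ δ ∧ skew p ∈ sojourn α β δ n := by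
  constructor
  · intro h
    exact ⟨h 0 (Nat.succ_pos n), fun k hk => h (k + 1) (Nat.succ_lt_succ hk)⟩
  · rintro ⟨h0, h⟩ k hk
    cases k with
    | zero => exact h0
    | succ k => exact h k (Nat.lt_of_succ_lt_succ hk)

theorem lsv_of_lt {γ x : ℝ} (hx : 0 ≤ x) (hx1 : x < 1 / 2) :
    lsv γ x = x * (1 + (2 * x) ^ γ) := by
  rw [lsv, if_pos hx1, Real.mul_rpow two_pos.le hx]

theorem lsv_of_ge {γ x : ℝ} (hx : 1 / 2 ≤ x) : lsv γ x = 2 * x - 1 := by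
  rw [lsv, if_neg (not_lt.2 hx)]

end Measurability

/-! ### Conditioning on the first parameter, and Chernoff bounds for sojourns. -/

section Shift

variable {α β : ℝ} (ν : Measure (Set.Icc α β)) [IsProbabilityMeasure ν]

/-- Prepend a parameter to a parameter sequence. -/
def consParam (q : Set.Icc α β × Params α β) : Params α β
  | 0 => q.1
  | n + 1 => q.2 n

theorem measurable_consParam : Measurable (consParam (α := α) (β := β)) := by
  refine measurable_pi_iff.2 fun n => ?_
  cases n with
  | zero => exact measurable_fst
  | succ n => exact (measurable_pi_apply n).comp measurable_snd

theorem map_consParam :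
    (ν.prod (Measure.infinitePi fun _ : ℕ => ν)).map consParam =
      Measure.infinitePi fun _ : ℕ => ν := by
  classical
  refine Measure.eq_infinitePi _ fun s t ht => ?_
  obtain ⟨N, hN⟩ : ∃ N, s ⊆ Finset.range (N + 1) :=
    ⟨s.sup id, fun i hi => Finset.mem_range.2 (Nat.lt_succ_of_le (Finset.le_sup (f := id) hi))⟩
  -- Padding the box with full factors makes its base an initial segment of ℕ, which splits into
  -- head and tail.
  set t' : ℕ → Set (Set.Icc α β) := fun i => if i ∈ s then t i else Set.univ with ht'
  have ht'm : ∀ i, MeasurableSet (t' i) := fun i => by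
    simp only [ht']; split_ifs
    exacts [ht i, MeasurableSet.univ]
  have hpre : consParam ⁻¹' Set.pi (s : Set ℕ) t =
      t' 0 ×ˢ Set.pi (Finset.range N : Set ℕ) fun i => t' (i + 1) := by
    ext q
    simp only [Set.mem_preimage, Set.mem_pi, Set.mem_prod, Finset.mem_coe, Finset.mem_range, ht']
    constructor
    · intro h
      refine ⟨?_, fun i _ => ?_⟩
      · split_ifs with h0
        exacts [h 0 h0, trivial]
      · split_ifs with h0
        exacts [h (i + 1) h0, trivial]
    · rintro ⟨h0, h⟩ i hi
      cases i with
      | zero => simpa [hi, consParam] using h0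
      | succ i =>
        have := h i (Nat.lt_of_succ_lt_succ (Finset.mem_range.1 (hN hi)))
        simpa [hi, consParam] using this
  rw [Measure.map_apply measurable_consParam
    (MeasurableSet.pi s.countable_toSet fun i _ => ht i), hpre, Measure.prod_prod,
    Measure.infinitePi_pi _ fun i _ => ht'm _, mul_comm,
    ← Finset.prod_range_succ' (fun i => ν (t' i)),
    ← Finset.prod_subset hN (f := fun i => ν (t' i)) fun i _ hi => by simp [ht', hi]]
  exact Finset.prod_congr rfl fun i hi => by simp [ht', hi]

/-- Integrating out the first parameter. -/
theorem infinitePi_skew_preimage {S : Set (Params α β × ℝ)} (hS : MeasurableSet S) (x : ℝ) :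
    Measure.infinitePi (fun _ : ℕ => ν) {ω | skew (ω, x) ∈ S} =
      ∫⁻ γ, Measure.infinitePi (fun _ : ℕ => ν) {ω | (ω, lsv γ x) ∈ S} ∂ν := by
  have hm : MeasurableSet {ω : Params α β | skew (ω, x) ∈ S} :=
    (measurable_skew.comp measurable_prodMk_right) hS
  conv_lhs => rw [← map_consParam ν]
  rw [Measure.map_apply measurable_consParam hm,
    Measure.prod_apply (measurable_consParam hm)]
  rfl

/-- For u = θw with |u| ≤ ε ≤ 1 one has e^u ≤ 1 + u + u² and u² ≤ ε|θ|w, which is linear in w.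
Integrate using mean one, then apply 1 + y ≤ e^y. -/
theorem lintegral_exp_le {w : Set.Icc α β → ℝ} (hw : Continuous w) (hw0 : ∀ γ, 0 ≤ w γ)
    (hw1 : ∫ γ, w γ ∂ν = 1) {θ ε : ℝ} (hε : ε ≤ 1) (hθ : ∀ γ, |θ| * w γ ≤ ε) (A : ℝ) :
    ∫⁻ γ, ENNReal.ofReal (Real.exp (A + θ * w γ)) ∂ν ≤
      ENNReal.ofReal (Real.exp (A + θ + ε * |θ|)) := by
  have hpt : ∀ γ, Real.exp (A + θ * w γ) ≤ Real.exp A * (1 + (θ + ε * |θ|) * w γ) := by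
    intro γ
    have habs : |θ * w γ| ≤ ε := by rw [abs_mul, abs_of_nonneg (hw0 γ)]; exact hθ γ
    have h1 := (abs_le.1 (Real.abs_exp_sub_one_sub_id_le (habs.trans hε))).2
    have h2 : (θ * w γ) ^ 2 ≤ ε * |θ| * w γ := by
      rw [← sq_abs, sq, abs_mul, abs_of_nonneg (hw0 γ), mul_assoc ε]
      exact mul_le_mul_of_nonneg_right (hθ γ) (mul_nonneg (abs_nonneg _) (hw0 γ))
    rw [Real.exp_add]
    gcongr
    linarith
  have hi : Integrable (fun γ => Real.exp A * (1 + (θ + ε * |θ|) * w γ)) ν :=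
    integrable_of_continuous (by fun_prop)
  refine (lintegral_mono fun γ => ENNReal.ofReal_le_ofReal (hpt γ)).trans ?_
  rw [← ofReal_integral_eq_lintegral_ofReal hi
    (Eventually.of_forall fun γ => (Real.exp_pos _).le.trans (hpt γ))]
  refine ENNReal.ofReal_le_ofReal ?_
  rw [integral_const_mul, integral_add (integrable_const _)
    ((integrable_of_continuous hw).const_mul _), integral_const_mul, hw1, add_assoc, Real.exp_add]
  have := Real.add_one_le_exp (θ + ε * |θ|)
  simp only [integral_const, probReal_univ, smul_eq_mul, mul_one]
  gcongr
  linarith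

variable {ν}

theorem integral_weight_eq_one {x : ℝ} (hx : 0 < x) :
    ∫ γ : Set.Icc α β, (2 * x) ^ (γ : ℝ) * (moment ν x)⁻¹ ∂ν = 1 := by
  rw [integral_mul_const]
  exact mul_inv_cancel₀ (moment_pos hx).ne'

theorem continuous_weight {μ : Measure (Set.Icc α β)} {x : ℝ} (hx : 0 < x) :
    Continuous fun γ : Set.Icc α β => (2 * x) ^ (γ : ℝ) * (moment μ x)⁻¹ :=
  (continuous_rpow_param (by positivity)).mul continuous_const

theorem le_lsv {γ x : ℝ} (hx : 0 ≤ x) (hx1 : x < 1 / 2) : x ≤ lsv γ x := by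
  rw [lsv_of_lt hx hx1]
  have : 0 ≤ (2 * x) ^ γ := by positivity
  nlinarith

/-- Chernoff bound for long sojourns near the neutral fixed point. -/
theorem measure_sojourn_le {δ z a l ε : ℝ} (hδ : δ < 1 / 2) (hz : 0 < z) (ha : 0 ≤ a) (hl : 0 ≤ l)
    (hε : ε ≤ 1)
    (hstep : ∀ x, z ≤ x → x ≤ δ → ∀ γ : Set.Icc α β,
      (moment ν (lsv γ x))⁻¹ ≤ (moment ν x)⁻¹ - a * ((2 * x) ^ (γ : ℝ) * (moment ν x)⁻¹))
    (hsmall : ∀ x, z ≤ x → x ≤ δ → ∀ γ : Set.Icc α β,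
      l * a * ((2 * x) ^ (γ : ℝ) * (moment ν x)⁻¹) ≤ ε) (n : ℕ) :
    ∀ x, z ≤ x → Measure.infinitePi (fun _ : ℕ => ν) {ω | (ω, x) ∈ sojourn α β δ n} ≤
      ENNReal.ofReal (Real.exp (l * ((moment ν x)⁻¹ - (1 - ε) * a * n))) := by
  induction n with
  | zero =>
    intro x hx
    refine prob_le_one.trans ?_
    rw [ENNReal.one_le_ofReal, Real.one_le_exp_iff]
    have := moment_pos (ν := ν) (hz.trans_le hx)
    simp only [CharP.cast_eq_zero, mul_zero, sub_zero]
    positivity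
  | succ n ih =>
    intro x hx
    have hx0 := hz.trans_le hx
    rcases lt_or_ge δ x with hxδ | hxδ
    · have : {ω : Params α β | (ω, x) ∈ sojourn α β δ (n + 1)} = ∅ := by
        ext ω; simp [mem_sojourn_succ, hxδ]
      simp [this]
    · have : {ω : Params α β | (ω, x) ∈ sojourn α β δ (n + 1)} =
          {ω | skew (ω, x) ∈ sojourn α β δ n} := by
        ext ω; simp [mem_sojourn_succ, hxδ]
      rw [this, infinitePi_skew_preimage ν (measurableSet_sojourn δ n)]
      have hla : |-(l * a)| = l * a := by rw [abs_neg, abs_of_nonneg (by positivity)]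
      have hq := moment_pos (ν := ν) hx0
      -- The induction hypothesis applies after the step because the left branch moves points
      -- upwards, keeping them above z. Averaging over γ then costs -la + εla = -(1-ε)la in the
      -- exponent.
      refine (lintegral_mono (g := fun γ : Set.Icc α β => ENNReal.ofReal (Real.exp
        (l * ((moment ν x)⁻¹ - (1 - ε) * a * n) +
          -(l * a) * ((2 * x) ^ (γ : ℝ) * (moment ν x)⁻¹)))) fun γ => ?_).trans
        ((lintegral_exp_le ν (continuous_weight hx0) (fun γ => by positivity)
          (integral_weight_eq_one hx0) hε (fun γ => ?_) _).trans ?_)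
      · refine (ih _ (hx.trans (le_lsv hx0.le (hxδ.trans_lt hδ)))).trans
          (ENNReal.ofReal_le_ofReal (Real.exp_le_exp.2 ?_))
        have := mul_le_mul_of_nonneg_left (hstep x hx hxδ γ) hl
        linarith
      · rw [hla]; exact hsmall x hx hxδ γ
      · refine ENNReal.ofReal_le_ofReal (Real.exp_le_exp.2 ?_)
        rw [hla]; push_cast
        apply le_of_eq; ring

/-- Chernoff bound for short sojourns near the neutral fixed point. -/
theorem measure_compl_sojourn_le (hα : 0 ≤ α) {δ z a l ε : ℝ} (hδ0 : 0 < δ) (hδ : δ < 1 / 2)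
    (hz : 0 < z) (ha : 0 ≤ a) (hl : 0 ≤ l) (hε0 : 0 ≤ ε) (hε : ε ≤ 1)
    (hstep : ∀ x, z ≤ x → x ≤ δ → ∀ γ : Set.Icc α β,
      (moment ν x)⁻¹ - a * ((2 * x) ^ (γ : ℝ) * (moment ν x)⁻¹) ≤ (moment ν (lsv γ x))⁻¹)
    (hsmall : ∀ x, z ≤ x → x ≤ δ → ∀ γ : Set.Icc α β,
      l * a * ((2 * x) ^ (γ : ℝ) * (moment ν x)⁻¹) ≤ ε) (n : ℕ) :
    ∀ x, z ≤ x → Measure.infinitePi (fun _ : ℕ => ν) {ω | (ω, x) ∈ (sojourn α β δ n)ᶜ} ≤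
      ENNReal.ofReal (Real.exp
        (l * ((moment ν δ)⁻¹ - (moment ν x)⁻¹ + (1 + ε) * a * n))) := by
  induction n with
  | zero => intro x _; simp [sojourn]
  | succ n ih =>
    intro x hx
    have hx0 := hz.trans_le hx
    have hq := moment_pos (ν := ν) hx0
    rcases lt_or_ge δ x with hxδ | hxδ
    -- Beyond δ the exponent is nonnegative, so the bound is trivial.
    · refine prob_le_one.trans ?_
      rw [ENNReal.one_le_ofReal, Real.one_le_exp_iff]
      have h1 : (moment ν x)⁻¹ ≤ (moment ν δ)⁻¹ :=
        inv_anti₀ (moment_pos hδ0) (moment_mono hα hδ0 hxδ.le)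
      have h2 : 0 ≤ (1 + ε) * a * ((n + 1 : ℕ) : ℝ) := by positivity
      exact mul_nonneg hl (by linarith)
    · have : {ω : Params α β | (ω, x) ∈ (sojourn α β δ (n + 1))ᶜ} =
          {ω | skew (ω, x) ∈ (sojourn α β δ n)ᶜ} := by
        ext ω; simp [mem_sojourn_succ, hxδ]
      rw [this, infinitePi_skew_preimage ν (measurableSet_sojourn δ n).compl]
      have hla : |l * a| = l * a := abs_of_nonneg (by positivity)
      refine (lintegral_mono (g := fun γ : Set.Icc α β => ENNReal.ofReal (Real.exp
        (l * ((moment ν δ)⁻¹ - (moment ν x)⁻¹ + (1 + ε) * a * n) +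
          (l * a) * ((2 * x) ^ (γ : ℝ) * (moment ν x)⁻¹)))) fun γ => ?_).trans
        ((lintegral_exp_le ν (continuous_weight hx0) (fun γ => by positivity)
          (integral_weight_eq_one hx0) hε (fun γ => ?_) _).trans ?_)
      · refine (ih _ (hx.trans (le_lsv hx0.le (hxδ.trans_lt hδ)))).trans
          (ENNReal.ofReal_le_ofReal (Real.exp_le_exp.2 ?_))
        have := mul_le_mul_of_nonneg_left (hstep x hx hxδ γ) hl
        linarith
      · rw [hla]; exact hsmall x hx hxδ γ
      · refine ENNReal.ofReal_le_ofReal (Real.exp_le_exp.2 ?_)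
        rw [hla]; push_cast
        apply le_of_eq; ring

/-- The numerator is at most (2x)^α and the moment at least a constant times (2x)^(3α/2), so the
weight grows no faster than x^(-α/2). -/
theorem weight_le (hα : 0 < α) {x z : ℝ} (hν : 0 < ν.real {γ | (γ : ℝ) ≤ α + α / 2})
    (hz : 0 < z) (hzx : z ≤ x) (hx1 : 2 * x ≤ 1) (γ : Set.Icc α β) :
    z ^ (α / 2) * ((2 * x) ^ (γ : ℝ) * (moment ν x)⁻¹) ≤
      (ν.real {γ : Set.Icc α β | (γ : ℝ) ≤ α + α / 2})⁻¹ := by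
  have hx := hz.trans_le hzx
  set m := ν.real {γ : Set.Icc α β | (γ : ℝ) ≤ α + α / 2}
  have h1 := le_moment (ν := ν) hx hx1 (α / 2)
  have h2 : (2 * x) ^ (γ : ℝ) ≤ (2 * x) ^ α :=
    Real.rpow_le_rpow_of_exponent_ge (by positivity) hx1 γ.2.1
  have h3 : z ^ (α / 2) ≤ (2 * x) ^ (α / 2) :=
    Real.rpow_le_rpow hz.le (by linarith) (by positivity)
  rw [Real.rpow_add (by positivity)] at h1
  have hq := moment_pos (ν := ν) hx
  rw [← mul_assoc, ← div_eq_mul_inv, ← one_div, div_le_div_iff₀ hq hν]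
  have : z ^ (α / 2) * (2 * x) ^ (γ : ℝ) ≤ (2 * x) ^ (α / 2) * (2 * x) ^ α := by gcongr
  nlinarith

/-- Of the two factors 1 ∓ ε in each exponent, one comes from the drift of the reciprocal moment and
one from the second-order Chernoff error. The constant c depends on neither δ nor z. -/
theorem exists_sojourn_bounds (hα : 0 < α)
    (hν : ∀ δ : ℝ, 0 < δ → 0 < ν {γ | (γ : ℝ) ≤ α + δ}) {ε : ℝ} (hε : 0 < ε) (hε1 : ε ≤ 1) :
    ∃ δ₀ : ℝ, 0 < δ₀ ∧ δ₀ < 1 / 2 ∧ ∃ c : ℝ, 0 < c ∧ ∀ δ, 0 < δ → δ ≤ δ₀ → ∀ z, 0 < z →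
      ∀ (n : ℕ) (x : ℝ), z ≤ x →
      Measure.infinitePi (fun _ : ℕ => ν) {ω | (ω, x) ∈ sojourn α β δ n} ≤
        ENNReal.ofReal (Real.exp
          (c * z ^ (α / 2) * ((moment ν x)⁻¹ - (1 - ε) ^ 2 * (α * n)))) ∧
      Measure.infinitePi (fun _ : ℕ => ν) {ω | (ω, x) ∈ (sojourn α β δ n)ᶜ} ≤
        ENNReal.ofReal (Real.exp
          (c * z ^ (α / 2) *
            ((moment ν δ)⁻¹ - (moment ν x)⁻¹ + (1 + ε) ^ 2 * (α * n)))) := by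
  obtain ⟨δ₀, hδ₀, hδ₀', hstep⟩ := inv_moment_step hα hν hε
  set m := ν.real {γ : Set.Icc α β | (γ : ℝ) ≤ α + α / 2} with hm_def
  have hm : 0 < m := measureReal_param_pos hν (half_pos hα)
  -- Chosen so that the Chernoff increments are at most ε for both drifts α(1 ± ε), each at most 2α.
  refine ⟨δ₀, hδ₀, hδ₀', ε * m / (2 * α), by positivity, ?_⟩
  intro δ hδ hδδ z hz n x hzx
  have hsmall : ∀ a, 0 ≤ a → a ≤ 2 * α → ∀ x, z ≤ x → x ≤ δ → ∀ γ : Set.Icc α β,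
      ε * m / (2 * α) * z ^ (α / 2) * a * ((2 * x) ^ (γ : ℝ) * (moment ν x)⁻¹) ≤ ε := by
    intro a ha ha' x hx hxδ γ
    have h1 := weight_le hα hm hz hx (by linarith) γ
    have h0 : ε * m / (2 * α) * a ≤ ε * m := by
      rw [div_mul_eq_mul_div, div_le_iff₀ (by positivity)]
      gcongr
    calc _ = ε * m / (2 * α) * a *
          (z ^ (α / 2) * ((2 * x) ^ (γ : ℝ) * (moment ν x)⁻¹)) := by ring
      _ ≤ ε * m * m⁻¹ := by
        have := moment_pos (ν := ν) (hz.trans_le hx)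
        have := hz.trans_le hx
        gcongr
      _ = ε := by field_simp
  have hlsv : ∀ x, z ≤ x → x ≤ δ → ∀ γ : Set.Icc α β,
      lsv γ x = x * (1 + (2 * x) ^ (γ : ℝ)) := fun x hx hxδ γ =>
    lsv_of_lt (hz.le.trans hx) (by linarith)
  constructor
  · have h := measure_sojourn_le (ν := ν) (δ := δ) (z := z) (a := α * (1 - ε))
      (l := ε * m / (2 * α) * z ^ (α / 2)) (by linarith) hz
      (mul_nonneg hα.le (by linarith)) (by positivity) hε1
      (fun x hx hxδ γ => by
        rw [hlsv x hx hxδ γ]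
        exact (hstep x (hz.trans_le hx) (hxδ.trans hδδ) γ).2)
      (hsmall _ (mul_nonneg hα.le (by linarith)) (by nlinarith)) n x hzx
    convert h using 4
    ring
  · have h := measure_compl_sojourn_le (ν := ν) (δ := δ) (z := z) (a := α * (1 + ε))
      (l := ε * m / (2 * α) * z ^ (α / 2)) hα.le hδ (by linarith) hz
      (mul_nonneg hα.le (by linarith)) (by positivity) hε.le hε1
      (fun x hx hxδ γ => by
        rw [hlsv x hx hxδ γ]
        exact (hstep x (hz.trans_le hx) (hxδ.trans hδδ) γ).1)
      (hsmall _ (mul_nonneg hα.le (by linarith)) (by nlinarith)) n x hzx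
    convert h using 4
    ring

end Shift

/-! ### Reduction to a uniformly distributed entry point. -/

section Induced

variable {α β : ℝ} (ν : Measure (Set.Icc α β)) [IsProbabilityMeasure ν]

theorem refMeasure_restrict_inducing :
    (refMeasure ν).restrict (inducing α β) =
      (Measure.infinitePi fun _ : ℕ => ν).prod (volume.restrict (Set.Icc (1 / 2 : ℝ) 1)) := by
  have h : Set.Icc (1 / 2 : ℝ) 1 ∩ Set.Icc 0 1 = Set.Icc (1 / 2) 1 :=
    Set.inter_eq_left.2 (Set.Icc_subset_Icc_left (by norm_num))
  rw [refMeasure, inducing, ← Measure.prod_restrict, Measure.restrict_univ,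
    Measure.restrict_restrict measurableSet_Icc, h]

theorem refMeasure_inducing : refMeasure ν (inducing α β) = 2⁻¹ := by
  rw [← Measure.restrict_apply_univ, refMeasure_restrict_inducing, ← Set.univ_prod_univ,
    Measure.prod_prod]
  simp only [measure_univ, one_mul, Measure.restrict_apply_univ, Real.volume_Icc]
  rw [show (1 : ℝ) - 1 / 2 = 2⁻¹ by norm_num, ENNReal.ofReal_inv_of_pos two_pos]
  simp

theorem inducedMeasure_eq :
    inducedMeasure ν = (2 : ENNReal) •
      (Measure.infinitePi fun _ : ℕ => ν).prod (volume.restrict (Set.Icc (1 / 2 : ℝ) 1)) := by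
  rw [inducedMeasure, ProbabilityTheory.cond, refMeasure_inducing, refMeasure_restrict_inducing,
    inv_inv]

instance : IsProbabilityMeasure (inducedMeasure ν) :=
  cond_isProbabilityMeasure_of_finite (by simp [refMeasure_inducing])
    (by simp [refMeasure_inducing])

theorem inducedMeasure_apply {S : Set (Params α β × ℝ)} (hS : MeasurableSet S) :
    inducedMeasure ν S =
      2 * ∫⁻ x in Set.Icc (1 / 2 : ℝ) 1, Measure.infinitePi (fun _ : ℕ => ν) {ω | (ω, x) ∈ S} := by
  rw [inducedMeasure_eq, Measure.smul_apply, Measure.prod_apply_symm hS, smul_eq_mul]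
  rfl

theorem ae_inducedMeasure : ∀ᵐ p ∂inducedMeasure ν, 1 / 2 < p.2 ∧ p.2 ≤ 1 := by
  have hm : MeasurableSet {p : Params α β × ℝ | 1 / 2 < p.2 ∧ p.2 ≤ 1} :=
    measurable_snd measurableSet_Ioc
  rw [ae_iff]
  change inducedMeasure ν {p : Params α β × ℝ | 1 / 2 < p.2 ∧ p.2 ≤ 1}ᶜ = 0
  rw [inducedMeasure_apply ν hm.compl, mul_eq_zero]
  right
  refine (lintegral_congr_ae (g := fun _ => 0) ?_).trans (by simp)
  have h1 : ∀ᵐ x : ℝ ∂volume.restrict (Set.Icc (1 / 2 : ℝ) 1), x ≠ 1 / 2 :=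
    ae_restrict_of_ae (by simp [ae_iff])
  filter_upwards [h1, ae_restrict_mem measurableSet_Icc] with x hx hx'
  have : 1 / 2 < x := lt_of_le_of_ne hx'.1 (Ne.symm hx)
  simp only [Set.mem_compl_iff, Set.mem_ofPred_eq, this, hx'.2, and_self, not_true]
  simp

/-- The probability that the excursion from the inducing set stays below `δ` for `n` steps. -/
def sojournProb (δ : ℝ) (n : ℕ) : ℝ := (inducedMeasure ν).real {p | skew p ∈ sojourn α β δ n}

theorem sojournProb_eq (δ : ℝ) (n : ℕ) :
    ENNReal.ofReal (sojournProb ν δ n) = 2 * ∫⁻ x in Set.Icc (1 / 2 : ℝ) 1,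
      Measure.infinitePi (fun _ : ℕ => ν) {ω | (ω, 2 * x - 1) ∈ sojourn α β δ n} := by
  rw [sojournProb, ofReal_measureReal,
    inducedMeasure_apply ν (S := {p | skew p ∈ sojourn α β δ n})
      (measurable_skew (measurableSet_sojourn δ n))]
  congr 1
  refine setLIntegral_congr_fun measurableSet_Icc fun x hx => ?_
  have := infinitePi_skew_preimage ν (measurableSet_sojourn δ n) x
  simp only [lsv_of_ge hx.1, lintegral_const, measure_univ, mul_one] at this
  exact this

/-- Entry points below z have probability z and are bounded trivially; the rest satisfy the
hypothesis. -/
theorem sojournProb_le {δ z e : ℝ} (hz : 0 ≤ z) (hz1 : z ≤ 1) (he : 0 ≤ e) {n : ℕ}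
    (h : ∀ x, z ≤ x →
      Measure.infinitePi (fun _ : ℕ => ν) {ω | (ω, x) ∈ sojourn α β δ n} ≤ ENNReal.ofReal e) :
    sojournProb ν δ n ≤ z + e := by
  rw [← ENNReal.ofReal_le_ofReal_iff (by positivity), sojournProb_eq]
  have hsub : Set.Icc (1 / 2 : ℝ) ((1 + z) / 2) ⊆ Set.Icc (1 / 2) 1 :=
    Set.Icc_subset_Icc_right (by linarith)
  have hle : ∫⁻ x in Set.Icc (1 / 2 : ℝ) 1,
      Measure.infinitePi (fun _ : ℕ => ν) {ω | (ω, 2 * x - 1) ∈ sojourn α β δ n} ≤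
      ∫⁻ x in Set.Icc (1 / 2 : ℝ) 1,
        ((Set.Icc (1 / 2 : ℝ) ((1 + z) / 2)).indicator 1 x + ENNReal.ofReal e) := by
    refine setLIntegral_mono' measurableSet_Icc fun x hx => ?_
    by_cases hxz : x ≤ (1 + z) / 2
    · rw [Set.indicator_of_mem (show x ∈ Set.Icc _ _ from ⟨hx.1, hxz⟩)]
      exact prob_le_one.trans le_self_add
    · exact (h _ (by linarith)).trans le_add_self
  refine (mul_le_mul_right hle 2).trans ?_
  rw [lintegral_add_right _ measurable_const, lintegral_indicator_one measurableSet_Icc,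
    Measure.restrict_apply measurableSet_Icc, Set.inter_eq_left.2 hsub, setLIntegral_const,
    Real.volume_Icc, Real.volume_Icc, ← ENNReal.ofReal_mul he,
    ← ENNReal.ofReal_add (by linarith) (by positivity),
    show (2 : ENNReal) = ENNReal.ofReal 2 by simp, ← ENNReal.ofReal_mul two_pos.le]
  exact ENNReal.ofReal_le_ofReal (by linarith)

theorem le_sojournProb {δ y z e : ℝ} (hy : 0 ≤ y) (hyz : y ≤ z) (hz : z ≤ 1) (he : 0 ≤ e)
    (he1 : e ≤ 1) {n : ℕ}
    (h : ∀ x, y ≤ x → x ≤ z →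
      Measure.infinitePi (fun _ : ℕ => ν) {ω | (ω, x) ∈ (sojourn α β δ n)ᶜ} ≤ ENNReal.ofReal e) :
    (z - y) * (1 - e) ≤ sojournProb ν δ n := by
  rw [← ENNReal.ofReal_le_ofReal_iff (p := (z - y) * (1 - e))
    (show 0 ≤ sojournProb ν δ n from measureReal_nonneg), sojournProb_eq]
  have hsub : Set.Icc ((1 + y) / 2) ((1 + z) / 2) ⊆ Set.Icc (1 / 2) 1 :=
    Set.Icc_subset_Icc (by linarith) (by linarith)
  have hle : ∫⁻ _ in Set.Icc ((1 + y) / 2) ((1 + z) / 2), ENNReal.ofReal (1 - e) ≤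
      ∫⁻ x in Set.Icc (1 / 2 : ℝ) 1,
        Measure.infinitePi (fun _ : ℕ => ν) {ω | (ω, 2 * x - 1) ∈ sojourn α β δ n} := by
    refine le_trans ?_ (lintegral_mono_set hsub)
    refine setLIntegral_mono' measurableSet_Icc fun x hx => ?_
    have h1 := h (2 * x - 1) (by linarith [hx.1]) (by linarith [hx.2])
    have hm : MeasurableSet {ω : Params α β | (ω, 2 * x - 1) ∈ sojourn α β δ n} :=
      measurable_prodMk_right (measurableSet_sojourn δ n)
    have h2 := prob_add_prob_compl (μ := Measure.infinitePi fun _ : ℕ => ν) hm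
    rw [ENNReal.ofReal_sub _ he, ENNReal.ofReal_one, ← h2]
    refine tsub_le_iff_right.2 ?_
    gcongr
    exact h1
  refine le_trans ?_ (mul_le_mul_right hle 2)
  rw [setLIntegral_const, Real.volume_Icc, ← ENNReal.ofReal_mul (by linarith),
    show (2 : ENNReal) = ENNReal.ofReal 2 by simp, ← ENNReal.ofReal_mul two_pos.le]
  exact ENNReal.ofReal_le_ofReal (by linarith)

end Induced

/-! ### Tail of the sojourn time. -/

section Asymptotics

variable {α β : ℝ} {ν : Measure (Set.Icc α β)} [IsProbabilityMeasure ν]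

theorem tendsto_inv_moment_atTop (hα : 0 < α) :
    Tendsto (fun z => (moment ν z)⁻¹) (𝓝[>] 0) atTop := by
  have h : Tendsto (moment ν) (𝓝[>] 0) (𝓝[>] 0) := by
    refine tendsto_nhdsWithin_iff.2 ⟨?_, ?_⟩
    · refine squeeze_zero' ?_ ?_ (tendsto_two_mul_rpow hα)
      · filter_upwards [self_mem_nhdsWithin] with x hx using (moment_pos hx).le
      · filter_upwards [Ioo_mem_nhdsGT (show (0 : ℝ) < 1 / 2 by norm_num)] with x hx
        exact moment_le hx.1 (by linarith [hx.2])
    · filter_upwards [self_mem_nhdsWithin] with x hx using moment_pos hx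
  exact h.inv_tendsto_nhdsGT_zero

/-- Since q(z) ≤ (2z)^α, the exponent is at least a constant times z^(-α/2), and the exponential
beats every power of z. -/
theorem eventually_exp_neg_le (hα : 0 < α) {c ε : ℝ} (hc : 0 < c) (hε : 0 < ε) :
    ∀ᶠ z in 𝓝[>] (0 : ℝ), Real.exp (-(c * z ^ (α / 2) * (moment ν z)⁻¹)) ≤ ε * z := by
  have h1 : Tendsto (fun z : ℝ => z ^ (-(α / 2))) (𝓝[>] 0) atTop :=
    tendsto_rpow_neg_nhdsGT_zero (by linarith)
  have hk : 0 < c * (2 ^ α)⁻¹ := by positivity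
  have h2 := (tendsto_rpow_mul_exp_neg_mul_atTop_nhds_zero (2 / α) _ hk).comp h1
  filter_upwards [h2.eventually (gt_mem_nhds hε),
    Ioo_mem_nhdsGT (show (0 : ℝ) < 1 / 2 by norm_num)] with z hz hz'
  have hz0 := hz'.1
  have h3 : (z ^ (-(α / 2))) ^ (2 / α) = z⁻¹ := by
    rw [← Real.rpow_mul hz0.le, ← Real.rpow_neg_one]
    congr 1; field_simp
  simp only [Function.comp, h3] at hz
  rw [inv_mul_lt_iff₀ hz0] at hz
  refine le_trans (Real.exp_le_exp.2 ?_) (hz.le.trans_eq (mul_comm _ _))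
  rw [neg_mul, neg_le_neg_iff]
  have h4 : ((2 * z) ^ α)⁻¹ ≤ (moment ν z)⁻¹ :=
    inv_anti₀ (moment_pos hz0) (moment_le hz0 (by linarith [hz'.2]))
  have h5 : z ^ (-(α / 2)) = z ^ (α / 2) * (z ^ α)⁻¹ := by
    rw [← Real.rpow_neg hz0.le, ← Real.rpow_add hz0]; ring_nf
  rw [Real.mul_rpow two_pos.le hz0.le, mul_inv] at h4
  calc c * (2 ^ α)⁻¹ * z ^ (-(α / 2))
      = c * z ^ (α / 2) * ((2 ^ α)⁻¹ * (z ^ α)⁻¹) := by rw [h5]; ring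
    _ ≤ _ := by gcongr

theorem sojournProb_asymptotics (hα : 0 < α)
    (hν : ∀ δ : ℝ, 0 < δ → 0 < ν {γ | (γ : ℝ) ≤ α + δ}) {ε : ℝ} (hε : 0 < ε) (hε1 : ε ≤ 1) :
    ∃ δ₀ : ℝ, 0 < δ₀ ∧ δ₀ < 1 / 2 ∧ ∀ δ, 0 < δ → δ ≤ δ₀ → ∀ᶠ z in 𝓝[>] (0 : ℝ), ∀ n : ℕ,
      ((1 + ε) * (moment ν z)⁻¹ ≤ α * n → sojournProb ν δ n ≤ (1 + ε) * z) ∧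
      (α * n ≤ (1 - ε) * (moment ν z)⁻¹ → (1 - ε) * z ≤ sojournProb ν δ n) := by
  obtain ⟨δ₀, hδ₀, hδ₀', c, hc, hb⟩ :=
    exists_sojourn_bounds hα hν (show 0 < ε / 8 by positivity) (by linarith)
  refine ⟨δ₀, hδ₀, hδ₀', fun δ hδ hδδ => ?_⟩
  have hη : 0 < (ε / 2) ^ (α / 2) := by positivity
  filter_upwards [eventually_exp_neg_le (ν := ν) hα (show 0 < c * (ε / 4) by positivity) hε,
    eventually_exp_neg_le (ν := ν) hα
      (show 0 < c * (ε / 2) ^ (α / 2) * (ε / 4) by positivity) (half_pos hε),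
    (tendsto_inv_moment_atTop (ν := ν) hα).eventually_ge_atTop ((moment ν δ)⁻¹ / (ε / 4)),
    Ioo_mem_nhdsGT (show (0 : ℝ) < 1 / 2 by norm_num)] with z h1 h2 h3 hz n
  have hz0 := hz.1
  have hV : 0 < (moment ν z)⁻¹ := inv_pos.2 (moment_pos hz0)
  constructor
  · intro hn
    refine (sojournProb_le ν (e := ε * z) hz0.le (by linarith [hz.2]) (by positivity)
      fun x hx => ?_).trans (by linarith)
    refine ((hb δ hδ hδδ z hz0 n x hx).1).trans (ENNReal.ofReal_le_ofReal (le_trans ?_ h1))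
    refine Real.exp_le_exp.2 ?_
    have h4 : (moment ν x)⁻¹ ≤ (moment ν z)⁻¹ :=
      inv_anti₀ (moment_pos hz0) (moment_mono hα.le hz0 hx)
    have h5 : (1 + ε / 4) * (moment ν z)⁻¹ ≤ (1 - ε / 8) ^ 2 * (α * n) := by
      have h6 : (1 - ε / 8) ^ 2 * ((1 + ε) * (moment ν z)⁻¹) ≤ (1 - ε / 8) ^ 2 * (α * n) := by
        gcongr
      have h7 : 1 + ε / 4 ≤ (1 - ε / 8) ^ 2 * (1 + ε) := by
        nlinarith [mul_nonneg hε.le (sub_nonneg.2 hε1),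
          mul_nonneg (mul_nonneg hε.le hε.le) hε.le]
      nlinarith
    have hl : 0 < c * z ^ (α / 2) := by positivity
    have h8 : (moment ν x)⁻¹ - (1 - ε / 8) ^ 2 * (α * n) ≤ -(ε / 4 * (moment ν z)⁻¹) := by
      linarith
    calc _ ≤ c * z ^ (α / 2) * -(ε / 4 * (moment ν z)⁻¹) := by gcongr
      _ = _ := by ring
  · intro hn
    -- For the lower bound only entry points in [εz/2, z] are used: dropping those below εz/2 loses
    -- little mass and keeps the Chernoff exponent of order z^(α/2).
    have hle : ε / 2 * z ≤ z := by nlinarith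
    refine le_trans ?_ (le_sojournProb ν (e := ε / 2 * z) (y := ε / 2 * z) (by positivity) hle
      (by linarith [hz.2]) (by positivity) (by linarith [hz.2]) fun x hx hxz => ?_)
    · have : ε / 2 * z ≤ ε / 2 := by nlinarith [hz.2]
      nlinarith [mul_nonneg (mul_nonneg hε.le hz0.le) (sub_nonneg.2 hε1), hz.2,
        mul_pos hε hz0, mul_pos (mul_pos hε hz0) hz0]
    · have hx0 : 0 < x := lt_of_lt_of_le (by positivity) hx
      refine ((hb δ hδ hδδ (ε / 2 * z) (by positivity) n x hx).2).trans
        (ENNReal.ofReal_le_ofReal (le_trans ?_ h2))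
      refine Real.exp_le_exp.2 ?_
      have h4 : (moment ν z)⁻¹ ≤ (moment ν x)⁻¹ :=
        inv_anti₀ (moment_pos hx0) (moment_mono hα.le hx0 hxz)
      have h5 : (1 + ε / 8) ^ 2 * (α * n) ≤ (1 - ε / 2) * (moment ν z)⁻¹ := by
        have h6 : (1 + ε / 8) ^ 2 * (α * n) ≤
            (1 + ε / 8) ^ 2 * ((1 - ε) * (moment ν z)⁻¹) := by gcongr
        have h7 : (1 + ε / 8) ^ 2 * (1 - ε) ≤ 1 - ε / 2 := by
          nlinarith [mul_nonneg hε.le (sub_nonneg.2 hε1),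
            mul_nonneg (mul_nonneg hε.le hε.le) hε.le]
        nlinarith
      -- For small z the fixed term 1/q(δ) is absorbed into (ε/4)/q(z).
      rw [div_le_iff₀ (by positivity)] at h3
      have hl : 0 < c * (ε / 2 * z) ^ (α / 2) := by positivity
      have h8 : (moment ν δ)⁻¹ - (moment ν x)⁻¹ + (1 + ε / 8) ^ 2 * (α * n) ≤
          -(ε / 4 * (moment ν z)⁻¹) := by linarith
      calc _ ≤ c * (ε / 2 * z) ^ (α / 2) * -(ε / 4 * (moment ν z)⁻¹) := by gcongr
        _ = _ := by rw [Real.mul_rpow (by positivity) hz0.le]; ring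

end Asymptotics

/-! ### Deterministic control of one excursion. -/

section Excursion

theorem lsv_lt_one {γ x : ℝ} (hγ : 0 ≤ γ) (hx : 0 < x) (hx1 : x < 1 / 2) : lsv γ x < 1 := by
  rw [lsv_of_lt hx.le hx1]
  have : (2 * x) ^ γ ≤ 1 := Real.rpow_le_one (by positivity) (by linarith) hγ
  nlinarith

/-- A lower bound on the advance uniform in the parameter and in points of [y, 1/2); it bounds the
number of steps spent away from 0. -/
theorem le_lsv_sub {β γ x y : ℝ} (hγ : γ ≤ β) (hy : 0 < y) (hγ0 : 0 ≤ γ) (hyx : y ≤ x)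
    (hx1 : x < 1 / 2) : y * (2 * y) ^ β ≤ lsv γ x - x := by
  have hx : 0 < x := hy.trans_le hyx
  have h1 : (2 * y) ^ β ≤ (2 * y) ^ γ :=
    Real.rpow_le_rpow_of_exponent_ge (by positivity) (by linarith) hγ
  have h2 : (2 * y) ^ γ ≤ (2 * x) ^ γ := Real.rpow_le_rpow (by positivity) (by linarith) hγ0
  have h3 : y * (2 * y) ^ β ≤ x * (2 * x) ^ γ := by
    gcongr
    exact h1.trans h2
  rw [lsv_of_lt hx.le hx1]
  linarith

variable {α β : ℝ}

theorem iterate_succ_snd (p : Params α β × ℝ) (k : ℕ) :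
    (skew^[k + 1] p).2 = lsv ((skew^[k] p).1 0) (skew^[k] p).2 := by
  rw [Function.iterate_succ_apply']; rfl

theorem mem_inducing {p : Params α β × ℝ} : p ∈ inducing α β ↔ 1 / 2 ≤ p.2 ∧ p.2 ≤ 1 := by
  simp [inducing]

theorem exists_iterate_mem_inducing (hα : 0 ≤ α) {p : Params α β × ℝ} (hp : 1 / 2 < p.2)
    (hp1 : p.2 ≤ 1) : ∃ n, 1 ≤ n ∧ skew^[n] p ∈ inducing α β := by
  by_contra! hcon
  set y := (skew^[1] p).2 with hy_def
  have hy : y = 2 * p.2 - 1 := lsv_of_ge hp.le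
  have hy0 : 0 < y := by linarith
  have key : ∀ n : ℕ, y + n * (y * (2 * y) ^ β) ≤ (skew^[n + 1] p).2 ∧
      (skew^[n + 1] p).2 < 1 / 2 := by
    intro n
    have hlt : ∀ m, (skew^[m + 1] p).2 ≤ 1 → (skew^[m + 1] p).2 < 1 / 2 := fun m hm => by
      by_contra! h
      exact hcon (m + 1) (by omega) (mem_inducing.2 ⟨h, hm⟩)
    induction n with
    | zero => exact ⟨by simp [hy_def], hlt 0 (by rw [zero_add, ← hy_def]; linarith)⟩
    | succ n ih =>
      obtain ⟨h1, h2⟩ := ih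
      set γ := (skew^[n + 1] p).1 0
      have hg : 0 ≤ (n : ℝ) * (y * (2 * y) ^ β) := by positivity
      have h3 := le_lsv_sub (β := β) γ.2.2 hy0 (hα.trans γ.2.1)
        (show y ≤ (skew^[n + 1] p).2 by linarith) h2
      have h4 : (skew^[n + 1 + 1] p).2 = lsv γ (skew^[n + 1] p).2 := iterate_succ_snd p (n + 1)
      refine ⟨?_, hlt (n + 1) ?_⟩
      · rw [h4]; push_cast; linarith
      · rw [h4]
        exact (lsv_lt_one (hα.trans γ.2.1) (by linarith) h2).le
  have hg : 0 < y * (2 * y) ^ β := by positivity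
  obtain ⟨n, hn⟩ := exists_nat_gt (1 / (y * (2 * y) ^ β))
  rw [div_lt_iff₀ hg] at hn
  have := key n
  linarith

theorem returnTime_spec (hα : 0 ≤ α) {p : Params α β × ℝ} (hp : 1 / 2 < p.2) (hp1 : p.2 ≤ 1) :
    1 ≤ returnTime p ∧ 1 / 2 ≤ (skew^[returnTime p] p).2 ∧ (skew^[returnTime p] p).2 ≤ 1 ∧
      ∀ k, 1 ≤ k → k < returnTime p → 0 < (skew^[k] p).2 ∧ (skew^[k] p).2 < 1 / 2 := by
  have hmem : returnTime p ∈ {n : ℕ | 1 ≤ n ∧ skew^[n] p ∈ inducing α β} :=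
    Nat.sInf_mem (exists_iterate_mem_inducing hα hp hp1)
  obtain ⟨h1, h2⟩ := hmem
  rw [mem_inducing] at h2
  refine ⟨h1, h2.1, h2.2, fun k hk1 hk => ?_⟩
  have hnot : ∀ k, 1 ≤ k → k < returnTime p → (skew^[k] p).2 ≤ 1 → (skew^[k] p).2 < 1 / 2 := by
    intro k hk1 hk hle
    by_contra! h
    exact Nat.notMem_of_lt_sInf hk ⟨hk1, mem_inducing.2 ⟨h, hle⟩⟩
  induction k, hk1 using Nat.le_induction with
  | base =>
    have hy : (skew^[1] p).2 = 2 * p.2 - 1 := lsv_of_ge hp.le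
    exact ⟨by linarith, hnot 1 le_rfl hk (by linarith)⟩
  | succ k hk1 ih =>
    obtain ⟨h3, h4⟩ := ih (by omega)
    have h5 := iterate_succ_snd p k
    set γ := (skew^[k] p).1 0
    refine ⟨?_, hnot (k + 1) (by omega) hk ?_⟩
    · rw [h5]; exact h3.trans_le (le_lsv h3.le h4)
    · rw [h5]; exact (lsv_lt_one (hα.trans γ.2.1) h3 h4).le

/-- A term above δ is paid for by its advance, at least δ(2δ)^β; these advances telescope to at most
1. The extra 1 covers the starting point in Y. -/
theorem sum_orbit_le (hα : 0 ≤ α) {δ : ℝ} (hδ : 0 < δ) {p : Params α β × ℝ} (hp : 1 / 2 < p.2)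
    (hp1 : p.2 ≤ 1) :
    ∑ i ∈ Finset.range (returnTime p), (skew^[i] p).2 ≤
      δ * returnTime p + (1 + 1 / (δ * (2 * δ) ^ β)) := by
  obtain ⟨h1, -, h3, h4⟩ := returnTime_spec hα hp hp1
  obtain ⟨M, hM⟩ : ∃ M, returnTime p = M + 1 := ⟨returnTime p - 1, by omega⟩
  have hg : 0 < δ * (2 * δ) ^ β := by positivity
  rw [hM] at h3 h4 ⊢
  have hstep : ∀ i ∈ Finset.range M, (skew^[i + 1] p).2 ≤
      δ + ((skew^[i + 1 + 1] p).2 - (skew^[i + 1] p).2) / (δ * (2 * δ) ^ β) := by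
    intro i hi
    obtain ⟨h5, h6⟩ := h4 (i + 1) (by omega) (by have := Finset.mem_range.1 hi; omega)
    rw [iterate_succ_snd p (i + 1)]
    set γ := (skew^[i + 1] p).1 0
    set x := (skew^[i + 1] p).2
    rcases le_or_gt x δ with hx | hx
    · have h7 : 0 ≤ (lsv γ x - x) / (δ * (2 * δ) ^ β) :=
        div_nonneg (sub_nonneg.2 (le_lsv h5.le h6)) hg.le
      linarith
    · have h7 : 1 ≤ (lsv γ x - x) / (δ * (2 * δ) ^ β) := by
        rw [one_le_div hg]
        exact le_lsv_sub γ.2.2 hδ (hα.trans γ.2.1) hx.le h6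
      linarith
  have hx1 : 0 ≤ (skew^[1] p).2 := by
    have hy : (skew^[1] p).2 = 2 * p.2 - 1 := lsv_of_ge hp.le
    linarith
  rw [Finset.sum_range_succ']
  have hsum := Finset.sum_le_sum hstep
  rw [Finset.sum_add_distrib, ← Finset.sum_div,
    Finset.sum_range_sub (fun i => (skew^[i + 1] p).2) M] at hsum
  have h8 : ((skew^[M + 1] p).2 - (skew^[0 + 1] p).2) / (δ * (2 * δ) ^ β) ≤
      1 / (δ * (2 * δ) ^ β) := by
    gcongr
    simp only [zero_add]
    linarith
  have h9 : (skew^[0] p).2 ≤ 1 := hp1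
  simp only [Finset.sum_const, Finset.card_range, nsmul_eq_mul] at hsum
  push_cast
  linarith

theorem lt_returnTime_of_sojourn (hα : 0 ≤ α) {δ : ℝ} (hδ : δ < 1 / 2) {p : Params α β × ℝ}
    (hp : 1 / 2 < p.2) (hp1 : p.2 ≤ 1) {n : ℕ} (h : skew p ∈ sojourn α β δ n) :
    n < returnTime p := by
  obtain ⟨h1, h2, -, -⟩ := returnTime_spec hα hp hp1
  by_contra! hle
  have h3 : (skew^[returnTime p - 1] (skew p)).2 ≤ δ := h _ (by omega)
  rw [← Function.iterate_succ_apply, Nat.succ_eq_add_one, Nat.sub_add_cancel h1] at h3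
  linarith

/-- Once above δ, the orbit gains at least δ(2δ)^β per step until it returns. -/
theorem returnTime_le_of_not_sojourn (hα : 0 ≤ α) {δ : ℝ} (hδ : 0 < δ) {p : Params α β × ℝ}
    (hp : 1 / 2 < p.2) (hp1 : p.2 ≤ 1) {n : ℕ} (h : skew p ∉ sojourn α β δ n) :
    (returnTime p : ℝ) ≤ n + (1 + 1 / (δ * (2 * δ) ^ β)) := by
  obtain ⟨h1, h2, h3, h4⟩ := returnTime_spec hα hp hp1
  have hg : 0 < δ * (2 * δ) ^ β := by positivity
  simp only [sojourn, Set.mem_ofPred_eq, not_forall, not_le] at h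
  obtain ⟨k, hk, hkδ⟩ := h
  rw [← Function.iterate_succ_apply, Nat.succ_eq_add_one] at hkδ
  rcases le_or_gt (returnTime p) (k + 1) with hle | hgt
  · have h5 : (returnTime p : ℝ) ≤ n := by exact_mod_cast hle.trans hk
    have : 0 ≤ 1 + 1 / (δ * (2 * δ) ^ β) := by positivity
    linarith
  · have key : ∀ j : ℕ, k + 1 + j ≤ returnTime p →
        δ + j * (δ * (2 * δ) ^ β) ≤ (skew^[k + 1 + j] p).2 := by
      intro j
      induction j with
      | zero => intro _; simpa using hkδ.le
      | succ j ih =>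
        intro hj
        have h5 := ih (by omega)
        obtain ⟨h6, h7⟩ := h4 (k + 1 + j) (by omega) (by omega)
        have h8 := iterate_succ_snd p (k + 1 + j)
        set γ := (skew^[k + 1 + j] p).1 0
        have h9 : 0 ≤ (j : ℝ) * (δ * (2 * δ) ^ β) := by positivity
        have h10 := le_lsv_sub (β := β) γ.2.2 hδ (hα.trans γ.2.1)
          (show δ ≤ (skew^[k + 1 + j] p).2 by linarith) h7
        rw [← add_assoc, h8]
        push_cast
        linarith
    obtain ⟨j, hj⟩ : ∃ j, returnTime p = k + 1 + j := ⟨returnTime p - (k + 1), by omega⟩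
    have h5 := key j hj.ge
    rw [← hj] at h5
    have h6 : (j : ℝ) ≤ 1 / (δ * (2 * δ) ^ β) := by
      rw [le_div_iff₀ hg]; linarith
    have h7 : (k : ℝ) ≤ n := by exact_mod_cast hk.le
    rw [hj]; push_cast
    linarith

theorem abs_inducedObs_sub_le (hα : 0 ≤ α) {φ : ℝ → ℝ} {K : NNReal}
    (hφ : LipschitzOnWith K φ (Set.Icc 0 1)) {δ : ℝ} (hδ : 0 < δ) {p : Params α β × ℝ}
    (hp : 1 / 2 < p.2) (hp1 : p.2 ≤ 1) :
    |inducedObs φ p - φ 0 * returnTime p| ≤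
      K * (δ * returnTime p + (1 + 1 / (δ * (2 * δ) ^ β))) := by
  obtain ⟨-, -, -, h4⟩ := returnTime_spec hα hp hp1
  have hmem : ∀ i < returnTime p, (skew^[i] p).2 ∈ Set.Icc (0 : ℝ) 1 := by
    intro i hi
    rcases Nat.eq_zero_or_pos i with rfl | h0
    · exact ⟨by simp only [Function.iterate_zero, id_eq]; linarith, hp1⟩
    · have := h4 i h0 hi
      exact ⟨this.1.le, by linarith⟩
  have h1 : inducedObs φ p - φ 0 * returnTime p =
      ∑ i ∈ Finset.range (returnTime p), (φ (skew^[i] p).2 - φ 0) := by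
    rw [inducedObs, Finset.sum_sub_distrib]
    simp [mul_comm]
  rw [h1]
  refine (Finset.abs_sum_le_sum_abs _ _).trans ?_
  refine le_trans ?_ (mul_le_mul_of_nonneg_left (sum_orbit_le (β := β) hα hδ hp hp1) K.2)
  rw [Finset.mul_sum]
  refine Finset.sum_le_sum fun i hi => ?_
  have hi' := hmem i (Finset.mem_range.1 hi)
  have h2 := hφ.dist_le_mul _ hi' 0 (by simp)
  rwa [Real.dist_eq, Real.dist_eq, sub_zero, abs_of_nonneg hi'.1] at h2

/-- By the Lipschitz bound |φ(x) - φ(0)| ≤ Kx, the error is at most Kδ per step plus a constant. The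
condition on Kδ makes it a relative error ε, and C is uniform in p and n. -/
theorem inducedObs_bounds (hα : 0 ≤ α) {φ : ℝ → ℝ} {K : NNReal}
    (hφ : LipschitzOnWith K φ (Set.Icc 0 1)) (hφ0 : 0 < φ 0) {ε : ℝ} (hε : 0 < ε) (hε1 : ε ≤ 1)
    {δ : ℝ} (hδ : 0 < δ) (hδ2 : δ < 1 / 2) (hKδ : K * δ ≤ ε * φ 0) :
    ∃ C : ℝ, 0 ≤ C ∧ ∀ p : Params α β × ℝ, 1 / 2 < p.2 → p.2 ≤ 1 → ∀ n : ℕ,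
      (skew p ∈ sojourn α β δ n → (1 - ε) * φ 0 * n ≤ inducedObs φ p + C) ∧
      (skew p ∉ sojourn α β δ n → inducedObs φ p ≤ (1 + ε) * φ 0 * n + C) := by
  set B := 1 + 1 / (δ * (2 * δ) ^ β) with hB_def
  have hB : 0 ≤ B := by positivity
  have hK : (0 : ℝ) ≤ K := K.2
  refine ⟨K * B + (1 + ε) * φ 0 * B, by positivity, fun p hp hp1 n => ?_⟩
  have h1 := abs_le.1 (abs_inducedObs_sub_le hα hφ hδ hp hp1)
  rw [← hB_def, mul_add, ← mul_assoc] at h1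
  have h2 : K * δ * returnTime p ≤ ε * φ 0 * returnTime p := by gcongr
  constructor
  · intro h
    have h3 : (n : ℝ) ≤ returnTime p := by
      exact_mod_cast (lt_returnTime_of_sojourn hα hδ2 hp hp1 h).le
    have h4 : (1 - ε) * φ 0 * n ≤ (1 - ε) * φ 0 * returnTime p :=
      mul_le_mul_of_nonneg_left h3 (mul_nonneg (by linarith) hφ0.le)
    have : 0 ≤ (1 + ε) * φ 0 * B := by positivity
    linarith
  · intro h
    have h3 := returnTime_le_of_not_sojourn (β := β) hα hδ hp hp1 h
    rw [← hB_def] at h3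
    have h4 : (1 + ε) * φ 0 * returnTime p ≤ (1 + ε) * φ 0 * (n + B) := by gcongr
    linarith

variable (ν : Measure (Set.Icc α β)) [IsProbabilityMeasure ν]

/-- Monotonicity of the measure compares the sublevel set with a measurable sojourn set, so
measurability of the observable is not needed. -/
theorem tail_le_sojournProb {φ : ℝ → ℝ} {δ t : ℝ} {n : ℕ}
    (h : ∀ p : Params α β × ℝ, 1 / 2 < p.2 → p.2 ≤ 1 → skew p ∉ sojourn α β δ n →
      inducedObs φ p ≤ t) : 1 - distFun ν φ t ≤ sojournProb ν δ n := by
  have hm : MeasurableSet {p : Params α β × ℝ | skew p ∈ sojourn α β δ n} :=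
    measurable_skew (measurableSet_sojourn δ n)
  have h1 : (inducedMeasure ν).real {p : Params α β × ℝ | skew p ∈ sojourn α β δ n}ᶜ ≤
      distFun ν φ t := by
    refine ENNReal.toReal_mono (measure_ne_top _ _) (measure_mono_ae ?_)
    filter_upwards [ae_inducedMeasure ν] with p hp hps using h p hp.1 hp.2 hps
  rw [probReal_compl_eq_one_sub hm] at h1
  rw [sojournProb]
  linarith

theorem sojournProb_le_tail {φ : ℝ → ℝ} {δ t : ℝ} {n : ℕ}
    (h : ∀ p : Params α β × ℝ, 1 / 2 < p.2 → p.2 ≤ 1 → skew p ∈ sojourn α β δ n →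
      t < inducedObs φ p) : sojournProb ν δ n ≤ 1 - distFun ν φ t := by
  have hm : MeasurableSet {p : Params α β × ℝ | skew p ∈ sojourn α β δ n} :=
    measurable_skew (measurableSet_sojourn δ n)
  have h1 : distFun ν φ t ≤
      (inducedMeasure ν).real {p : Params α β × ℝ | skew p ∈ sojourn α β δ n}ᶜ := by
    refine ENNReal.toReal_mono (measure_ne_top _ _) (measure_mono_ae ?_)
    filter_upwards [ae_inducedMeasure ν] with p hp hps hs
    exact absurd (h p hp.1 hp.2 hs) (not_lt.2 hps)
  rw [probReal_compl_eq_one_sub hm] at h1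
  rw [sojournProb]
  linarith

end Excursion

/-! ### Tail of the induced observable and its regular variation. -/

section RegularVariation

variable {α β : ℝ} {ν : Measure (Set.Icc α β)} [IsProbabilityMeasure ν]

theorem tail_asymptotics (hα : 0 < α)
    (hν : ∀ δ : ℝ, 0 < δ → 0 < ν {γ | (γ : ℝ) ≤ α + δ}) {φ : ℝ → ℝ} {K : NNReal}
    (hφ : LipschitzOnWith K φ (Set.Icc 0 1)) (hφ0 : 0 < φ 0) {ε : ℝ} (hε : 0 < ε)
    (hε1 : ε ≤ 1) :
    ∀ᶠ z in 𝓝[>] (0 : ℝ), ∀ t : ℝ,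
      ((1 + ε) * (moment ν z)⁻¹ ≤ α / φ 0 * t → 1 - distFun ν φ t ≤ (1 + ε) * z) ∧
      (α / φ 0 * t ≤ (1 - ε) * (moment ν z)⁻¹ → (1 - ε) * z ≤ 1 - distFun ν φ t) := by
  have hη : 0 < ε / 4 := by positivity
  obtain ⟨δ₀, hδ₀, hδ₀', hS⟩ := sojournProb_asymptotics hα hν hη (by linarith)
  obtain ⟨δ, hδ, hδδ, hKδ⟩ : ∃ δ, 0 < δ ∧ δ ≤ δ₀ ∧ K * δ ≤ ε / 4 * φ 0 := by
    refine ⟨min δ₀ (ε / 4 * φ 0 / (K + 1)), by positivity, min_le_left _ _, ?_⟩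
    have h1 : min δ₀ (ε / 4 * φ 0 / (K + 1)) ≤ ε / 4 * φ 0 / (K + 1) := min_le_right _ _
    have h2 : (0 : ℝ) ≤ K := K.2
    calc K * min δ₀ (ε / 4 * φ 0 / (K + 1)) ≤ K * (ε / 4 * φ 0 / (K + 1)) := by gcongr
      _ = ε / 4 * φ 0 * (K / (K + 1)) := by ring
      _ ≤ ε / 4 * φ 0 * 1 := by
        gcongr
        rw [div_le_one (by positivity)]
        linarith
      _ = _ := mul_one _
  obtain ⟨C, hC, hobs⟩ := inducedObs_bounds (α := α) (β := β) hα.le hφ hφ0 hη (by linarith) hδ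
    (hδδ.trans_lt hδ₀') hKδ
  set κ := α / φ 0 with hκ_def
  have hκ : 0 < κ := by positivity
  have hακ : α = κ * φ 0 := by rw [hκ_def]; field_simp
  filter_upwards [hS δ hδ hδδ, self_mem_nhdsWithin,
    -- Makes 1/q(z) large enough to absorb both C and the rounding of n to an integer.
    (tendsto_inv_moment_atTop (ν := ν) hα).eventually_ge_atTop ((κ * C + 2 * α) / (ε / 4))]
    with z hz hz0 hV t
  have hz0 : 0 < z := hz0
  rw [div_le_iff₀ hη] at hV
  set V := (moment ν z)⁻¹
  have hV0 : 0 < V := inv_pos.2 (moment_pos hz0)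
  have hκC : 0 ≤ κ * C := by positivity
  constructor
  · intro ht
    have hD : 0 < (1 + ε / 4) * φ 0 := by positivity
    -- The largest n for which leaving the sojourn set by time n forces the bound φ_Y ≤ t.
    set n := ⌊(t - C) / ((1 + ε / 4) * φ 0)⌋₊ with hn_def
    have h1 : (1 + ε / 4) ^ 2 * V + α * (1 + ε / 4) ≤ κ * (t - C) := by nlinarith
    have h2 : 0 ≤ (t - C) / ((1 + ε / 4) * φ 0) := by
      refine div_nonneg ?_ hD.le
      by_contra! hneg
      have : κ * (t - C) < 0 := mul_neg_of_pos_of_neg hκ hneg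
      have : 0 ≤ (1 + ε / 4) ^ 2 * V + α * (1 + ε / 4) := by positivity
      linarith
    have h3 := Nat.floor_le h2
    have h4 := Nat.lt_floor_add_one ((t - C) / ((1 + ε / 4) * φ 0))
    rw [← hn_def] at h3 h4
    rw [le_div_iff₀ hD] at h3
    rw [div_lt_iff₀ hD] at h4
    have h5 : (1 + ε / 4) * V ≤ α * n := by
      have h6 : κ * (t - C) ≤ (1 + ε / 4) * (α * n + α) := by
        rw [hακ]
        nlinarith
      have h7 : (1 + ε / 4) * ((1 + ε / 4) * V) ≤ (1 + ε / 4) * (α * n) := by nlinarith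
      exact le_of_mul_le_mul_left h7 (by positivity)
    have h8 := (hz n).1 h5
    refine (tail_le_sojournProb ν (δ := δ) (n := n) fun p hp hp1 hs => ?_).trans
      (h8.trans (by nlinarith))
    have := (hobs p hp hp1 n).2 hs
    linarith
  · intro ht
    have hD : 0 < (1 - ε / 4) * φ 0 := mul_pos (by linarith) hφ0
    -- The +1 makes (1 - ε/4) φ(0) n exceed t + C strictly, as the event φ_Y > t requires.
    set n := ⌊(t + C) / ((1 - ε / 4) * φ 0)⌋₊ + 1 with hn_def
    have h4 := Nat.lt_floor_add_one ((t + C) / ((1 - ε / 4) * φ 0))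
    have h4' : (t + C) / ((1 - ε / 4) * φ 0) < n := by rw [hn_def]; push_cast; exact h4
    rw [div_lt_iff₀ hD] at h4'
    have h5 : α * n ≤ (1 - ε / 4) * V := by
      rcases le_or_gt 0 ((t + C) / ((1 - ε / 4) * φ 0)) with h2 | h2
      · have h3 := Nat.floor_le h2
        rw [le_div_iff₀ hD] at h3
        set N : ℝ := (⌊(t + C) / ((1 - ε / 4) * φ 0)⌋₊ : ℝ)
        have hnN : (n : ℝ) = N + 1 := by rw [hn_def]; push_cast; rfl
        have h6 : (1 - ε / 4) * (α * N) ≤ κ * (t + C) := by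
          rw [hακ]
          nlinarith
        have h7 : (1 - ε / 4) * (α * n) ≤ (1 - ε / 4) * ((1 - ε / 4) * V) := by
          rw [hnN]
          nlinarith [mul_pos hη hα, mul_nonneg (mul_nonneg hη.le hη.le) hV0.le]
        exact le_of_mul_le_mul_left h7 (by linarith)
      -- Here t is an arbitrary real; for negative t + C the natural floor is 0.
      · have h3 : n = 1 := by rw [hn_def, Nat.floor_of_nonpos h2.le]
        rw [h3]
        push_cast
        nlinarith
    have h8 := (hz n).2 h5
    refine le_trans (by nlinarith) (h8.trans
      (sojournProb_le_tail ν (δ := δ) (n := n) fun p hp hp1 hs => ?_))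
    have := (hobs p hp hp1 n).1 hs
    linarith

/-- Intermediate value theorem between a point near 0, where 1/q is large, and 1/2, where q = 1. -/
theorem exists_inv_moment_eq (hα : 0 < α) {s : ℝ} (hs : 1 ≤ s) :
    ∃ z : ℝ, 0 < z ∧ (moment ν z)⁻¹ = s := by
  obtain ⟨w, hw, hw0⟩ := (((tendsto_inv_moment_atTop (ν := ν) hα).eventually_ge_atTop s).and
    (Ioo_mem_nhdsGT (show (0 : ℝ) < 1 / 2 by norm_num))).exists
  have hcont : ContinuousOn (fun z => (moment ν z)⁻¹) (Set.Icc w (1 / 2)) :=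
    ((continuousOn_moment hα).mono fun z hz => hw0.1.trans_le hz.1).inv₀ fun z hz =>
      (moment_pos (hw0.1.trans_le hz.1)).ne'
  have h1 : (moment ν (1 / 2))⁻¹ = 1 := by simp [moment]
  obtain ⟨z, hz, hzs⟩ := intermediate_value_Icc' hw0.2.le hcont
    (show s ∈ Set.Icc _ _ from ⟨h1.trans_le hs, hw⟩)
  exact ⟨z, hw0.1.trans_le hz.1, hzs⟩

theorem exists_asymptotic_inverse (hα : 0 < α) {κ : ℝ} (hκ : 0 < κ) :
    ∃ z : ℝ → ℝ, (∀ᶠ t in atTop, (moment ν (z t))⁻¹ = κ * t) ∧ Tendsto z atTop (𝓝[>] 0) := by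
  have hex : ∀ t : ℝ, ∃ w : ℝ, 0 < w ∧ (1 ≤ κ * t → (moment ν w)⁻¹ = κ * t) := by
    intro t
    by_cases h : 1 ≤ κ * t
    · obtain ⟨w, hw, hws⟩ := exists_inv_moment_eq (ν := ν) hα h
      exact ⟨w, hw, fun _ => hws⟩
    · exact ⟨1, one_pos, fun h' => absurd h' h⟩
  choose z hz0 hz using hex
  have hlim : Tendsto (fun t => κ * t) atTop atTop := tendsto_id.const_mul_atTop hκ
  refine ⟨z, (hlim.eventually_ge_atTop 1).mono hz, tendsto_nhdsWithin_iff.2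
    ⟨?_, Eventually.of_forall hz0⟩⟩
  refine tendsto_order.2 ⟨fun a ha => Eventually.of_forall fun t => ha.trans (hz0 t),
    fun a ha => ?_⟩
  filter_upwards [hlim.eventually_ge_atTop 1, hlim.eventually_gt_atTop (moment ν a)⁻¹]
    with t h1 h2
  by_contra! hle
  have := inv_anti₀ (moment_pos ha) (moment_mono (ν := ν) hα.le ha hle)
  rw [hz t h1] at this
  linarith

theorem tendsto_inv_moment_mul_div
    (hν : ∀ δ : ℝ, 0 < δ → 0 < ν {γ | (γ : ℝ) ≤ α + δ}) {d : ℝ} (hd : 0 < d) :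
    Tendsto (fun x => (moment ν (d * x))⁻¹ / (moment ν x)⁻¹) (𝓝[>] 0) (𝓝 (d ^ α)⁻¹) := by
  refine ((tendsto_moment_mul_div hν hd).inv₀ (by positivity)).congr fun x => ?_
  rw [inv_div_inv, inv_div]

/-- Compare the tail at ct with d·z(t): regular variation gives 1/q(d z(t)) ≈ d^(-α)αt/φ(0), which
meets cαt/φ(0) exactly at d = c^(-1/α). Any d on either side gives a one-sided bound. -/
theorem tendsto_tail_div (hα : 0 < α)
    (hν : ∀ δ : ℝ, 0 < δ → 0 < ν {γ | (γ : ℝ) ≤ α + δ}) {φ : ℝ → ℝ} {K : NNReal}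
    (hφ : LipschitzOnWith K φ (Set.Icc 0 1)) (hφ0 : 0 < φ 0) {z : ℝ → ℝ}
    (hzV : ∀ᶠ t in atTop, (moment ν (z t))⁻¹ = α / φ 0 * t) (hz : Tendsto z atTop (𝓝[>] 0))
    {c : ℝ} (hc : 0 < c) :
    Tendsto (fun t => (1 - distFun ν φ (c * t)) / z t) atTop (𝓝 (c ^ (-(1 / α)))) := by
  have hl : (c ^ (-(1 / α))) ^ α = c⁻¹ := by
    rw [← Real.rpow_mul hc.le, ← Real.rpow_neg_one]
    congr 1; field_simp
  have hl0 : 0 < c ^ (-(1 / α)) := by positivity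
  have hscale : ∀ d : ℝ, 0 < d → Tendsto (fun t => d * z t) atTop (𝓝[>] 0) := by
    intro d hd
    obtain ⟨h1, h2⟩ := tendsto_nhdsWithin_iff.1 hz
    refine tendsto_nhdsWithin_iff.2 ⟨by simpa using h1.const_mul d, ?_⟩
    filter_upwards [h2] with t ht using mul_pos hd ht
  have hz0 : ∀ᶠ t in atTop, 0 < z t := (tendsto_nhdsWithin_iff.1 hz).2
  refine tendsto_order.2 ⟨fun u hu => ?_, fun u hu => ?_⟩
  -- The maximum with 0 keeps d positive even when u is negative.
  · obtain ⟨d, hd1, hd2⟩ := exists_between (max_lt hu hl0)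
    have hd0 : 0 < d := (le_max_right _ _).trans_lt hd1
    have hud : u < d := (le_max_left _ _).trans_lt hd1
    have hcd : c < (d ^ α)⁻¹ := by
      rw [lt_inv_comm₀ hc (by positivity), ← hl]
      exact Real.rpow_lt_rpow hd0.le hd2 hα
    have hlim1 : Tendsto (fun ε : ℝ => (1 - ε) * d) (𝓝[>] 0) (𝓝 d) := by
      have : ContinuousAt (fun ε : ℝ => (1 - ε) * d) 0 := by fun_prop
      simpa using this.tendsto.mono_left nhdsWithin_le_nhds
    have hlim2 : Tendsto (fun ε : ℝ => (1 - ε) * (d ^ α)⁻¹) (𝓝[>] 0) (𝓝 (d ^ α)⁻¹) := by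
      have : ContinuousAt (fun ε : ℝ => (1 - ε) * (d ^ α)⁻¹) 0 := by fun_prop
      simpa using this.tendsto.mono_left nhdsWithin_le_nhds
    obtain ⟨ε, ⟨he1, he2⟩, he⟩ := (((hlim1.eventually (lt_mem_nhds hud)).and
      (hlim2.eventually (lt_mem_nhds hcd))).and
      (Ioo_mem_nhdsGT (zero_lt_one (α := ℝ)))).exists
    have hlim3 := ((tendsto_inv_moment_mul_div hν hd0).const_mul (1 - ε)).comp hz
    filter_upwards [(hscale d hd0).eventually
      (tail_asymptotics hα hν hφ hφ0 he.1 he.2.le), hlim3.eventually (lt_mem_nhds he2), hzV, hz0]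
      with t h1 h2 h3 h4
    have hV : 0 < (moment ν (z t))⁻¹ := inv_pos.2 (moment_pos h4)
    simp only [Function.comp] at h2
    rw [← mul_div_assoc, lt_div_iff₀ hV] at h2
    have h5 := (h1 (c * t)).2 (by rw [h3] at h2; linarith)
    rw [lt_div_iff₀ h4]
    nlinarith
  · obtain ⟨d, hd1, hd2⟩ := exists_between hu
    have hd0 : 0 < d := hl0.trans hd1
    have hcd : (d ^ α)⁻¹ < c := by
      rw [inv_lt_comm₀ (by positivity) hc, ← hl]
      exact Real.rpow_lt_rpow hl0.le hd1 hα
    have hlim1 : Tendsto (fun ε : ℝ => (1 + ε) * d) (𝓝[>] 0) (𝓝 d) := by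
      have : ContinuousAt (fun ε : ℝ => (1 + ε) * d) 0 := by fun_prop
      simpa using this.tendsto.mono_left nhdsWithin_le_nhds
    have hlim2 : Tendsto (fun ε : ℝ => (1 + ε) * (d ^ α)⁻¹) (𝓝[>] 0) (𝓝 (d ^ α)⁻¹) := by
      have : ContinuousAt (fun ε : ℝ => (1 + ε) * (d ^ α)⁻¹) 0 := by fun_prop
      simpa using this.tendsto.mono_left nhdsWithin_le_nhds
    obtain ⟨ε, ⟨he1, he2⟩, he⟩ := (((hlim1.eventually (gt_mem_nhds hd2)).and
      (hlim2.eventually (gt_mem_nhds hcd))).and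
      (Ioo_mem_nhdsGT (zero_lt_one (α := ℝ)))).exists
    have hlim3 := ((tendsto_inv_moment_mul_div hν hd0).const_mul (1 + ε)).comp hz
    filter_upwards [(hscale d hd0).eventually
      (tail_asymptotics hα hν hφ hφ0 he.1 he.2.le), hlim3.eventually (gt_mem_nhds he2), hzV, hz0]
      with t h1 h2 h3 h4
    have hV : 0 < (moment ν (z t))⁻¹ := inv_pos.2 (moment_pos h4)
    simp only [Function.comp] at h2
    rw [← mul_div_assoc, div_lt_iff₀ hV] at h2
    have h5 := (h1 (c * t)).1 (by rw [h3] at h2; linarith)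
    rw [div_lt_iff₀ h4]
    nlinarith

theorem monotone_distFun (φ : ℝ → ℝ) : Monotone (distFun ν φ) := fun _ _ hst =>
  measureReal_mono fun _ hp => le_trans hp hst

end RegularVariation

end RandomLSV

end

theorem mainTheorem7 {α β : ℝ} (hα : 0 < α) (hα1 : α < 1) (hαβ : α ≤ β)
    (ν : MeasureTheory.Measure (Set.Icc α β)) [MeasureTheory.IsProbabilityMeasure ν]
    (hν : ∀ δ : ℝ, 0 < δ → 0 < ν {γ | (γ : ℝ) ≤ α + δ})
    (φ : ℝ → ℝ) (hφ : ∃ K : NNReal, LipschitzOnWith K φ (Set.Icc 0 1)) (hφ0 : 0 < φ 0) :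
    ∃ L : ℝ → ℝ, RandomLSV.IsSlowlyVarying L ∧
      ∀ t : ℝ, 0 < t → 1 - RandomLSV.distFun ν φ t = t ^ (-(1 / α)) * L t := by
  open RandomLSV Filter Topology in
  obtain ⟨K, hφ⟩ := hφ
  obtain ⟨z, hzV, hz⟩ := exists_asymptotic_inverse (ν := ν) hα (show 0 < α / φ 0 by positivity)
  have hz0 : ∀ᶠ t in atTop, 0 < z t := (tendsto_nhdsWithin_iff.1 hz).2
  have hone : Tendsto (fun t => (1 - distFun ν φ t) / z t) atTop (𝓝 1) := by
    simpa using tendsto_tail_div hα hν hφ hφ0 hzV hz one_pos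
  refine ⟨fun t => t ^ (1 / α) * (1 - distFun ν φ t), ⟨?_, fun c hc => ?_⟩, fun t ht => ?_⟩
  · obtain ⟨X, hX⟩ := eventually_atTop.1 ((hone.eventually (lt_mem_nhds one_pos)).and
      (hz0.and (eventually_gt_atTop 0)))
    refine ⟨X, fun t ht => ?_, ?_⟩
    · obtain ⟨h1, h2, h3⟩ := hX t ht
      have := (div_pos_iff_of_pos_right h2).1 h1
      positivity
    · have h1 : Measurable fun t : ℝ => t ^ (1 / α) * (1 - distFun ν φ t) :=
        (measurable_id.pow_const _).mul (measurable_const.sub (monotone_distFun φ).measurable)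
      exact h1.comp measurable_subtype_coe
  -- Dividing the limits at c and at 1 cancels z(t), leaving c^(1/α)·c^(-1/α) = 1.
  · have h1 := ((tendsto_tail_div hα hν hφ hφ0 hzV hz hc).div hone one_ne_zero).const_mul
      (c ^ (1 / α))
    have h2 : c ^ (1 / α) * (c ^ (-(1 / α)) / 1) = 1 := by
      rw [div_one, ← Real.rpow_add hc, add_neg_cancel, Real.rpow_zero]
    rw [h2] at h1
    refine h1.congr' ?_
    filter_upwards [hz0, eventually_gt_atTop 0] with t h3 h4
    have h5 : 0 < t ^ (1 / α) := by positivity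
    simp only [Pi.div_apply]
    rw [div_div_div_cancel_right₀ h3.ne', Real.mul_rpow hc.le h4.le, ← mul_div_assoc,
      mul_comm (c ^ (1 / α)) (t ^ (1 / α)), mul_assoc, mul_div_mul_left _ _ h5.ne']
  · rw [← mul_assoc, ← Real.rpow_add ht, neg_add_cancel, Real.rpow_zero, one_mul]
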